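/- Let $h>0$. A central force potential on the plane is a function $V(x)=U(|x|)$, $x\in\mathbb R^2\setminus\{0\}$, with $U\in C^\infty((0,\infty))$. The pair $(g_{\mathrm{flat}},V)$ denotes the natural system with energy $H(x,v)=\frac12|v|^2+V(x)$ and Euler--Lagrange equation $\ddot x=-\nabla V(x)$ on $\mathbb R^2\setminus\{0\}$. Let $V_{\mathrm{Kep},h}(x)=-\frac1{|x|}+\frac h2$; its Hill region $\{V_{\mathrm{Kep},h}\le 0\}$ is $\mathcal H_0=\{x\in\mathbb R^2: 0<|x|\le 2/h\}$. Two potentials are equivalent if they agree on $\mathcal H_0$. The system $(g_{\mathrm{flat}},V)$ is Zoll at energy $\{H=0\}$ if there are non-collision maximal trajectories with $H=0$ and all of them are defined for all times, periodic, and (over one minimal period) of one and the same positive length in the Jacobi--Maupertuis metric $-2V\,g_{\mathrm{flat}}$; a maximal trajectory is a collision trajectory if it tends to the origin at a finite end of its interval of existence. For every $h>0$ there is an infinite-dimensional space $\mathcal V$ of pairwise non-equivalent central force potentials on the plane, containing $V_{\mathrm{Kep},h}$, each with Hill region $\{V\le 0\}$ equal to $\mathcal H_0$, such that $(g_{\mathrm{flat}},V)$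 is Zoll at energy $\{H=0\}$ for every $V\in\mathcal V$. Here infinite-dimensional means: there are an infinite-dimensional real Banach space $E$ with open unit ball $B$ and a bijection $B\to\mathcal V$, $a\mapsto V_a$, such that $(a,x)\mapsto V_a(x)$ is $C^\infty$ on $B\times(\mathbb R^2\setminus\{0\})$ and, for all $a\in B$ and $0\ne b\in E$, the derivative of $a\mapsto V_a$ at $a$ in direction $b$ is a function that is not identically zero on $\mathcal H_0$. -/

import Mathlib

open Set Filter Topology
open scoped ContDiff

/-- The Euclidean plane. -/
abbrev Plane : Type := EuclideanSpace ℝ (Fin 2)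

/-- A central force potential: a function `V` on the plane which away from the origin is a smooth
function of the distance to the origin. The value at the origin is irrelevant. -/
def IsCentralForcePotential (V : Plane → ℝ) : Prop :=
  ∃ U : ℝ → ℝ, ContDiffOn ℝ ∞ U (Ioi 0) ∧ ∀ x : Plane, x ≠ 0 → V x = U ‖x‖

/-- The Kepler potential, shifted by the constant `h / 2`, so that the Kepler energy level `-h / 2`
becomes the zero energy level. -/
noncomputable def keplerPotential (h : ℝ) (x : Plane) : ℝ :=
  -(1 / ‖x‖) + h / 2

/-- The total energy `H = |v|² / 2 + V(x)` of the natural system given by the flat metric and the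
potential `V`. -/
noncomputable def energy (V : Plane → ℝ) (x v : Plane) : ℝ :=
  ‖v‖ ^ 2 / 2 + V x

/-- The Hill region at zero energy: the projection of `{H = 0}` to the punctured plane. -/
def hillRegion (V : Plane → ℝ) : Set Plane :=
  {x | x ≠ 0 ∧ V x ≤ 0}

/-- Two potentials are equivalent if they agree on the Hill region of the shifted Kepler
potential. -/
def EquivalentPotentials (h : ℝ) (V W : Plane → ℝ) : Prop :=
  EqOn V W (hillRegion (keplerPotential h))

/-- `γ`, restricted to the nonempty open interval `I`, is a trajectory of energy zero: a curve in
the punctured plane with `H = 0` which solves the Euler-Lagrange equation `γ'' = -∇V(γ)` of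
`L(x, v) = |v|² / 2 - V(x)`. -/
structure IsZeroEnergyOrbit (V : Plane → ℝ) (I : Set ℝ) (γ : ℝ → Plane) : Prop where
  isOpen : IsOpen I
  ordConnected : I.OrdConnected
  nonempty : I.Nonempty
  ne_zero : ∀ t ∈ I, γ t ≠ 0
  differentiableAt : ∀ t ∈ I, DifferentiableAt ℝ γ t
  eulerLagrange : ∀ t ∈ I, HasDerivAt (deriv γ) (-gradient V (γ t)) t
  energy_eq_zero : ∀ t ∈ I, energy V (γ t) (deriv γ t) = 0

/-- A trajectory of energy zero which cannot be extended to a larger interval. -/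
def IsMaximalZeroEnergyOrbit (V : Plane → ℝ) (I : Set ℝ) (γ : ℝ → Plane) : Prop :=
  IsZeroEnergyOrbit V I γ ∧
    ∀ (J : Set ℝ) (δ : ℝ → Plane),
      IsZeroEnergyOrbit V J δ → I ⊆ J → EqOn γ δ I → J = I

/-- The trajectory `γ` on the open interval `I` is a collision trajectory: it runs into (or out of)
the origin at a finite endpoint of `I`. -/
def IsCollision (I : Set ℝ) (γ : ℝ → Plane) : Prop :=
  ∃ T ∈ closure I \ I, Tendsto γ (𝓝[I] T) (𝓝 0)

/-- `T` is the minimal positive period of `γ`. -/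
def IsMinimalPeriod (γ : ℝ → Plane) (T : ℝ) : Prop :=
  0 < T ∧ Function.Periodic γ T ∧ ∀ s, 0 < s → s < T → ¬ Function.Periodic γ s

/-- The length of `γ` on `[0, T]` in the Jacobi-Maupertuis metric `2 (0 - V) ⟨·, ·⟩` of the zero
energy level. -/
noncomputable def jacobiMaupertuisLength (V : Plane → ℝ) (γ : ℝ → Plane) (T : ℝ) : ℝ :=
  ∫ t in (0 : ℝ)..T, Real.sqrt (2 * (0 - V (γ t))) * ‖deriv γ t‖

/-- The system given by the flat metric and `V` is Zoll at energy `{H = 0}`: there are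
non-collision trajectories of zero energy, and all of them are defined for all times, periodic,
and of the same (positive) Jacobi-Maupertuis length. -/
def IsZollAtZeroEnergy (V : Plane → ℝ) : Prop :=
  (∃ (I : Set ℝ) (γ : ℝ → Plane), IsMaximalZeroEnergyOrbit V I γ ∧ ¬ IsCollision I γ) ∧
  ∃ ℓ : ℝ, 0 < ℓ ∧ ∀ (I : Set ℝ) (γ : ℝ → Plane),
    IsMaximalZeroEnergyOrbit V I γ → ¬ IsCollision I γ →
      I = univ ∧ ∃ T : ℝ, IsMinimalPeriod γ T ∧ jacobiMaupertuisLength V γ T = ℓ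

/-- The set `𝒱` of potentials is an infinite-dimensional space (as seen on the region `S`): it is
parametrized bijectively by the unit ball of an infinite-dimensional real Banach space, the
parametrization is smooth (jointly in the parameter and the point of the punctured plane) and it is
an immersion: its derivative in any nonzero direction is a function which does not vanish
identically on `S`. -/
def IsInfiniteDimensionalSpace (S : Set Plane) (𝒱 : Set (Plane → ℝ)) : Prop :=
  ∃ (E : Type) (_ : NormedAddCommGroup E) (_ : NormedSpace ℝ E),
    CompleteSpace E ∧ ¬ FiniteDimensional ℝ E ∧
    ∃ Φ : E → Plane → ℝ,
      BijOn Φ (Metric.ball 0 1) 𝒱 ∧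
      ContDiffOn ℝ ∞ (fun p : E × Plane => Φ p.1 p.2) (Metric.ball 0 1 ×ˢ {0}ᶜ) ∧
      ∀ a ∈ Metric.ball (0 : E) 1, ∀ b : E, b ≠ 0 →
        ∃ x ∈ S, x ≠ 0 ∧ fderiv ℝ (fun a' => Φ a' x) a b ≠ 0

/-! With `ρ = h r - 1` the shifted Kepler potential is `-(1 - ρ²) / (2 h r²)`. Keep this formula,
but tie `r` to `ρ` by `r = (1 + ρ) exp (g (ρ²)) / h`. For zero energy and angular momentum `j`, put
`e² = 1 - h j²`; conservation of energy becomes `(r r')² = (e² - ρ²) / h`, whatever `g` is. So `ρ =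
-e cos E` as in Kepler motion, and `g` affects only the rates at which time and polar angle advance
with `E`.

The angle advances at the rate `√(1 - e²) · d(log r)/dρ` and the Jacobi-Maupertuis length at the
rate `(1 - ρ²) · d(log r)/dρ / √h`, where `d(log r)/dρ = 1 / (1 + ρ) + 2 ρ g'(ρ²)`
(`radiusDeriv_div_radius`). The first summand gives the Kepler values. The second is odd in `ρ`, and
since `ρ² = e² - (e sin E)²` its contribution integrates to a function of `e sin E` (`twistAngle`,
`actionDefect`), which is lost over a full turn. Hence every orbit with `e < 1` closes up after one
turn and has length `2π / √h` (`isMinimalPeriod_and_length_eq`). The explicit orbits pass through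
every state of zero energy (`exists_orbit_through`), so by uniqueness for the equation of motion
there are no others; those with `e = 1` run into the origin.

It remains to let `g` vary in an infinite-dimensional space. On bounded sequences take `g(c) = ε
χ(c) ∑ bₙ cⁿ / n!` with a bump function `χ`. A small derivative keeps `r` increasing in `ρ`, so that
`ρ` is a smooth function of `r` and of the parameter (`exists_smooth_radial_inverse`); vanishing for
`c ≥ 1` fixes the Hill region. The potential determines `ρ²`, monotonicity determines the sign of
`ρ`, and so `g` is recovered on `(0, 1)` (`eq_of_equivalentPotentials`). The linearized argument
gives the immersion (`exists_fderiv_deformedPotential_ne_zero`). -/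

/-! ### An infinite-dimensional linear family of bump functions. -/

/-- The shift `(b₀, b₁, …) ↦ (b₁, b₂, …)` on the Banach space of bounded sequences. -/
noncomputable def leftShift :
    BoundedContinuousFunction ℕ ℝ →L[ℝ] BoundedContinuousFunction ℕ ℝ :=
  LinearMap.mkContinuous
    { toFun := fun b => b.compContinuous ⟨Nat.succ, continuous_of_discreteTopology⟩
      map_add' := fun _ _ => rfl
      map_smul' := fun _ _ => rfl } 1 (by
    intro b
    rw [one_mul]
    exact (BoundedContinuousFunction.norm_le (norm_nonneg _)).2 fun n => b.norm_coe_le_norm _)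

@[simp] lemma leftShift_apply (b : BoundedContinuousFunction ℕ ℝ) (n : ℕ) :
    leftShift b n = b (n + 1) := rfl

lemma leftShift_pow_apply_zero (b : BoundedContinuousFunction ℕ ℝ) (n : ℕ) :
    ∀ m, (leftShift ^ n) b m = b (m + n) := by
  induction n with
  | zero => intro m; simp
  | succ n ih =>
    intro m
    rw [pow_succ', mul_apply_eq_comp, leftShift_apply, ih]
    congr 1; ring

/-- The left shift is onto but kills `(1, 0, 0, …)`, which no endomorphism of a finite-dimensional
space can do. -/
lemma not_finiteDimensional_boundedSequences :
    ¬ FiniteDimensional ℝ (BoundedContinuousFunction ℕ ℝ) := by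
  intro hfin
  have hsurj : Function.Surjective (leftShift.toLinearMap) := by
    intro b
    refine ⟨BoundedContinuousFunction.ofNormedAddCommGroup (fun n => b (n - 1))
      continuous_of_discreteTopology ‖b‖ fun n => b.norm_coe_le_norm _, ?_⟩
    ext n
    change b (n + 1 - 1) = b n
    simp
  have hinj := LinearMap.injective_iff_surjective.2 hsurj
  let d : BoundedContinuousFunction ℕ ℝ :=
    BoundedContinuousFunction.ofNormedAddCommGroup (fun n => if n = 0 then 1 else 0)
      continuous_of_discreteTopology 1 (by intro n; split_ifs <;> simp)
  have hd : d = 0 := by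
    apply hinj
    rw [map_zero]
    ext n
    change (if n + 1 = 0 then (1 : ℝ) else 0) = 0
    simp
  have : d 0 = 1 := by change (if 0 = 0 then (1 : ℝ) else 0) = 1; simp
  rw [hd] at this
  simp at this

section ExponentialFamily

variable {E : Type*} [NormedAddCommGroup E] [NormedSpace ℝ E] [CompleteSpace E]

lemma contDiff_exp_smul_const (A : E →L[ℝ] E) :
    ContDiff ℝ ∞ (fun c : ℝ => NormedSpace.exp (c • A)) := by
  have h : ContDiff ℝ ∞ (fun x : E →L[ℝ] E => NormedSpace.exp x) :=
    contDiff_iff_contDiffAt.2 fun x => (NormedSpace.exp_analytic (𝕂 := ℝ) x).contDiffAt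
  exact h.comp (contDiff_id.smul contDiff_const)

/-- If the functionals `L ∘ Aⁿ` separate points, then a vector `b` is determined by the germ of
the function `c ↦ L (exp (c A) b)`. -/
lemma eq_zero_of_exp_smul_eq_zero {A : E →L[ℝ] E} {L : E →L[ℝ] ℝ}
    (hsep : ∀ b, (∀ n, L ((A ^ n) b) = 0) → b = 0) {b : E} {s : Set ℝ}
    (hs : IsOpen s) (hne : s.Nonempty)
    (hb : ∀ c ∈ s, L ((NormedSpace.exp (c • A)) b) = 0) : b = 0 := by
  -- Each derivative in `c` brings down one more factor `A`, and `s` is open, so the vanishing can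
  -- be differentiated repeatedly.
  have key : ∀ n : ℕ, ∀ c ∈ s, L ((A ^ n) ((NormedSpace.exp (c • A)) b)) = 0 := by
    intro n
    induction n with
    | zero => simpa using hb
    | succ n ih =>
      intro c hc
      have h1 : HasDerivAt (fun c : ℝ => L ((A ^ n) ((NormedSpace.exp (c • A)) b)))
          (L ((A ^ n) ((A * NormedSpace.exp (c • A)) b))) c := by
        have h0 := (hasDerivAt_exp_smul_const' (𝕂 := ℝ) A c).clm_apply (hasDerivAt_const c b)
        rw [map_zero, add_zero] at h0
        exact L.hasFDerivAt.comp_hasDerivAt c ((A ^ n).hasFDerivAt.comp_hasDerivAt c h0)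
      have h2 : (fun c : ℝ => L ((A ^ n) ((NormedSpace.exp (c • A)) b))) =ᶠ[𝓝 c] fun _ => 0 := by
        filter_upwards [hs.mem_nhds hc] with c hc using ih c hc
      have h3 := h1.unique ((hasDerivAt_const c (0 : ℝ)).congr_of_eventuallyEq h2)
      rw [pow_succ]
      exact h3
  obtain ⟨c, hc⟩ := hne
  have h0 : (NormedSpace.exp (c • A)) b = 0 := hsep _ fun n => key n c hc
  have hinv : NormedSpace.exp (-(c • A)) * NormedSpace.exp (c • A) = 1 := by
    let := NormedAlgebra.restrictScalars ℚ ℝ (E →L[ℝ] E)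
    have h1 := NormedSpace.exp_add_of_commute (Commute.neg_left (Commute.refl (c • A)))
    rw [neg_add_cancel, NormedSpace.exp_zero] at h1
    exact h1.symm
  have := congrArg (fun B : E →L[ℝ] E => B b) hinv
  simpa [h0] using this.symm

/-- The family is `G c = ε χ(c) L ∘ exp (c A)`. For the left shift and evaluation at `0`, the last
factor is the exponential generating function of the sequence. -/
lemma exists_smooth_linear_family_of_separating (A : E →L[ℝ] E) (L : E →L[ℝ] ℝ)
    (hsep : ∀ b, (∀ n, L ((A ^ n) b) = 0) → b = 0) :
    ∃ G : ℝ → E →L[ℝ] ℝ, ContDiff ℝ ∞ G ∧ (∀ c, 1 ≤ c → G c = 0) ∧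
      (∀ c, ‖deriv G c‖ ≤ 1 / 8) ∧ ∀ b, b ≠ 0 → ∃ c ∈ Ioo (0 : ℝ) 1, G c b ≠ 0 := by
  -- Equal to `1` on `[3/8, 5/8]` and zero outside `(1/4, 3/4)`.
  let χ : ContDiffBump (1 / 2 : ℝ) := ⟨1 / 8, 1 / 4, by norm_num, by norm_num⟩
  let K : ℝ → E →L[ℝ] ℝ :=
    fun c => χ c • L.comp (NormedSpace.exp (c • A))
  have hK : ContDiff ℝ ∞ K :=
    χ.contDiff.smul (contDiff_const.clm_comp (contDiff_exp_smul_const A))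
  have hsupp : HasCompactSupport K := χ.hasCompactSupport.smul_right
  obtain ⟨M, hM⟩ := (hK.continuous_deriv (by simp)).bounded_above_of_compact_support hsupp.deriv
  have hM0 : 0 ≤ M := (norm_nonneg _).trans (hM 0)
  let ε : ℝ := 1 / (8 * (M + 1))
  have hε : 0 < ε := by positivity
  refine ⟨fun c => ε • K c, hK.const_smul ε, ?_, ?_, ?_⟩
  · intro c hc
    have : χ c = 0 := χ.zero_of_le_dist (by
      rw [Real.dist_eq, abs_of_nonneg (by linarith)]
      change (1 / 4 : ℝ) ≤ _
      linarith)
    simp [K, this]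
  · intro c
    rw [deriv_fun_const_smul ε (hK.differentiable (by simp) c), norm_smul, Real.norm_eq_abs,
      abs_of_pos hε]
    calc ε * ‖deriv K c‖ ≤ ε * (M + 1) := by
          gcongr; exact (hM c).trans (by linarith)
      _ = 1 / 8 := by simp only [ε]; field_simp
  · intro b hb
    by_contra! hcon
    refine hb (eq_zero_of_exp_smul_eq_zero hsep (s := Ioo (3 / 8 : ℝ) (5 / 8)) isOpen_Ioo
      ⟨1 / 2, by norm_num, by norm_num⟩ fun c hc => ?_)
    have h1 := hcon c ⟨by linarith [hc.1], by linarith [hc.2]⟩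
    have hχ : χ c = 1 := χ.one_of_mem_closedBall (by
      rw [Metric.mem_closedBall, Real.dist_eq]
      change |c - 1 / 2| ≤ 1 / 8
      rw [abs_le]; constructor <;> linarith [hc.1, hc.2])
    simpa [K, hχ, hε.ne'] using h1

end ExponentialFamily

/-- A smooth family of functions of one variable, supported in `(0, 1)`, depending linearly and
injectively on a parameter in an infinite-dimensional Banach space. -/
theorem exists_smooth_linear_family :
    ∃ (E : Type) (_ : NormedAddCommGroup E) (_ : NormedSpace ℝ E),
      CompleteSpace E ∧ ¬ FiniteDimensional ℝ E ∧
      ∃ G : ℝ → E →L[ℝ] ℝ, ContDiff ℝ ∞ G ∧ (∀ c, 1 ≤ c → G c = 0) ∧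
        (∀ c, ‖deriv G c‖ ≤ 1 / 8) ∧ ∀ b, b ≠ 0 → ∃ c ∈ Ioo (0 : ℝ) 1, G c b ≠ 0 := by
  refine ⟨BoundedContinuousFunction ℕ ℝ, inferInstance, inferInstance, inferInstance,
    not_finiteDimensional_boundedSequences, ?_⟩
  exact exists_smooth_linear_family_of_separating leftShift
    (BoundedContinuousFunction.evalCLM ℝ 0) fun b hb => by
      ext n
      have := hb n
      rwa [BoundedContinuousFunction.evalCLM_apply, leftShift_pow_apply_zero, zero_add] at this

/-! ### Smooth inversion of the radial coordinate. -/

/-- A solution of an implicit equation which is locally unique depends smoothly on the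
parameter. -/
lemma ContDiffAt.of_implicit_eq_zero {P : Type*} [NormedAddCommGroup P] [NormedSpace ℝ P]
    [CompleteSpace P] {f : P × ℝ → ℝ} {Z : P → ℝ} {p : P} {m : ℝ}
    (hf : ContDiffAt ℝ ∞ f (p, Z p)) (hd : HasDerivAt (fun y => f (p, y)) m (Z p)) (hm : m ≠ 0)
    (h0 : f (p, Z p) = 0) (huniq : ∀ᶠ q in 𝓝 p, ∀ y, f (q, y) = 0 → y = Z q) :
    ContDiffAt ℝ ∞ Z p := by
  have hinv : (fderiv ℝ f (p, Z p) ∘L .inr ℝ P ℝ).IsInvertible := by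
    refine ⟨ContinuousLinearEquiv.smulLeft (Units.mk0 m hm), ?_⟩
    apply ContinuousLinearMap.ext_ring
    have h1 : HasDerivAt (fun y => f (p, y)) (fderiv ℝ f (p, Z p) (0, 1)) (Z p) :=
      (hf.differentiableAt (by simp)).hasFDerivAt.comp_hasDerivAt (Z p)
        ((hasDerivAt_const (Z p) p).prodMk (hasDerivAt_id (Z p)))
    have h2 := hd.unique h1
    simp [h2, Units.smul_def]
  have hn : (∞ : WithTop ℕ∞) ≠ 0 := by simp
  refine (hf.contDiffAt_implicitFunction hn hinv).congr_of_eventuallyEq ?_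
  filter_upwards [huniq, hf.eventually_apply_implicitFunction hn hinv] with q hq hq'
  exact (hq _ (hq'.trans h0)).symm

section RadialInverse

variable {E : Type*} [NormedAddCommGroup E] [NormedSpace ℝ E] {G : ℝ → E →L[ℝ] ℝ}

lemma hasDerivAt_apply_of_contDiff (hG : ContDiff ℝ ∞ G) (a : E) (c : ℝ) :
    HasDerivAt (fun c => G c a) (deriv G c a) c := by
  have h0 := ((hG.differentiable (by simp)) c).hasDerivAt.clm_apply (hasDerivAt_const c a)
  rwa [map_zero, add_zero] at h0

/-- On `[-1, 1]` the factor `2 ρ (1 + ρ)` is at most `4` in absolute value, so the bound `1 / 8`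
leaves at least `1 / 2`; for `ρ > 1` the family vanishes near `ρ²`. This is what makes the deformed
radius increasing. -/
lemma half_le_one_add_two_mul_deriv (hG0 : ∀ c, 1 ≤ c → G c = 0)
    (hG1 : ∀ c, ‖deriv G c‖ ≤ 1 / 8) {a : E} (ha : ‖a‖ < 1) {ρ : ℝ} (hρ : -1 ≤ ρ) :
    1 / 2 ≤ 1 + 2 * ρ * (1 + ρ) * deriv G (ρ ^ 2) a := by
  rcases le_or_gt ρ 1 with h1 | h1
  · have hb : |deriv G (ρ ^ 2) a| ≤ 1 / 8 := by
      calc |deriv G (ρ ^ 2) a| ≤ ‖deriv G (ρ ^ 2)‖ * ‖a‖ := (deriv G (ρ ^ 2)).le_opNorm a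
        _ ≤ 1 / 8 * 1 := by gcongr; exact hG1 _
        _ = 1 / 8 := by ring
    have hρ' : |2 * ρ * (1 + ρ)| ≤ 4 := by
      rw [abs_le]; constructor <;> nlinarith [sq_nonneg (ρ + 1 / 2)]
    have := abs_le.1 ((abs_mul _ _).le.trans (mul_le_mul hρ' hb (abs_nonneg _) (by norm_num)))
    linarith [this.1]
  · have h : G =ᶠ[𝓝 (ρ ^ 2)] fun _ => 0 := by
      filter_upwards [lt_mem_nhds (show 1 < ρ ^ 2 by nlinarith)] with c hc using hG0 c hc.le
    rw [h.deriv_eq]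
    norm_num

/-- In the logarithmic radial coordinate `y`, the perturbed radius is
`exp (y + G ((exp y - 1) ^ 2) a)`. -/
lemma hasDerivAt_log_radius (hG : ContDiff ℝ ∞ G) (a : E) (y : ℝ) :
    HasDerivAt (fun y => y + G ((Real.exp y - 1) ^ 2) a)
      (1 + 2 * (Real.exp y - 1) * (1 + (Real.exp y - 1)) * deriv G ((Real.exp y - 1) ^ 2) a)
      y := by
  have h := (hasDerivAt_apply_of_contDiff hG a ((Real.exp y - 1) ^ 2)).comp y
    (((Real.hasDerivAt_exp y).sub_const 1).pow 2)
  refine ((hasDerivAt_id y).add h).congr_deriv ?_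
  push_cast
  ring

/-- With `y = log (1 + ρ)` and `σ = log (h r)` the half-lines become the whole line, and the map `y
↦ σ` has slope at least `1 / 2`, hence is a bijection of `ℝ`. Joint smoothness of its inverse
follows from the implicit function theorem. -/
theorem exists_smooth_radial_inverse [CompleteSpace E] (hG : ContDiff ℝ ∞ G)
    (hG0 : ∀ c, 1 ≤ c → G c = 0) (hG1 : ∀ c, ‖deriv G c‖ ≤ 1 / 8) :
    ∃ Y : E → ℝ → ℝ,
      (∀ a, ‖a‖ < 1 → ∀ σ, Y a σ + G ((Real.exp (Y a σ) - 1) ^ 2) a = σ) ∧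
      (∀ a, ‖a‖ < 1 → ∀ y, Y a (y + G ((Real.exp y - 1) ^ 2) a) = y) ∧
      ∀ a, ‖a‖ < 1 → ∀ σ, ContDiffAt ℝ ∞ (fun p : E × ℝ => Y p.1 p.2) (a, σ) := by
  let ψ : E → ℝ → ℝ := fun a y => y + G ((Real.exp y - 1) ^ 2) a
  have hψ : ∀ a y, HasDerivAt (ψ a) _ y := fun a y => hasDerivAt_log_radius hG a y
  have hge : ∀ a, ‖a‖ < 1 → ∀ y, 1 / 2 ≤ deriv (ψ a) y := fun a ha y => by
    rw [(hψ a y).deriv]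
    exact half_le_one_add_two_mul_deriv hG0 hG1 ha (by linarith [Real.exp_pos y])
  have hmono : ∀ a, ‖a‖ < 1 → StrictMono (ψ a) := fun a ha =>
    strictMono_of_deriv_pos fun y => lt_of_lt_of_le (by norm_num) (hge a ha y)
  have hsurj : ∀ a, ‖a‖ < 1 → Function.Surjective (ψ a) := fun a ha => by
    have hdiff : Differentiable ℝ (ψ a) := fun y => (hψ a y).differentiableAt
    have hsub := mul_sub_le_image_sub_of_le_deriv hdiff (hge a ha)
    refine hdiff.continuous.surjective ?_ ?_
    · refine tendsto_atTop_mono' _ (f₁ := fun y => ψ a 0 + 1 / 2 * y) ?_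
        (tendsto_atTop_add_const_left _ _ (tendsto_id.const_mul_atTop (one_half_pos (α := ℝ))))
      filter_upwards [eventually_ge_atTop 0] with y hy
      linarith [hsub hy]
    · refine tendsto_atBot_mono' _ (f₁ := fun y => ψ a 0 + 1 / 2 * y) ?_
        (tendsto_atBot_add_const_left _ _ (tendsto_id.const_mul_atBot (one_half_pos (α := ℝ))))
      filter_upwards [eventually_le_atBot 0] with y hy
      linarith [hsub hy]
  let Y : E → ℝ → ℝ := fun a => Function.invFun (ψ a)
  have hY1 : ∀ a, ‖a‖ < 1 → ∀ σ, ψ a (Y a σ) = σ := fun a ha σ =>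
    Function.invFun_eq (hsurj a ha σ)
  have hY2 : ∀ a, ‖a‖ < 1 → ∀ y, Y a (ψ a y) = y := fun a ha =>
    Function.leftInverse_invFun (hmono a ha).injective
  refine ⟨Y, hY1, hY2, fun a ha σ => ?_⟩
  refine ContDiffAt.of_implicit_eq_zero (f := fun q : (E × ℝ) × ℝ => ψ q.1.1 q.2 - q.1.2)
    (Z := fun p : E × ℝ => Y p.1 p.2) ?_ ((hψ a (Y a σ)).sub_const σ) ?_ ?_ ?_
  · refine ContDiff.contDiffAt ?_
    have h1 : ContDiff ℝ ∞ (fun q : (E × ℝ) × ℝ => G ((Real.exp q.2 - 1) ^ 2)) :=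
      hG.comp (((Real.contDiff_exp.comp contDiff_snd).sub contDiff_const).pow 2)
    exact (contDiff_snd.add (h1.clm_apply (contDiff_fst.comp contDiff_fst))).sub
      (contDiff_snd.comp contDiff_fst)
  · exact (lt_of_lt_of_le (by norm_num) (half_le_one_add_two_mul_deriv hG0 hG1 ha
      (by linarith [Real.exp_pos (Y a σ)]))).ne'
  · simp [hY1 a ha]
  · have hopen : ∀ᶠ q : E × ℝ in 𝓝 (a, σ), ‖q.1‖ < 1 :=
      (continuous_fst.norm.tendsto (a, σ)).eventually (gt_mem_nhds ha)
    filter_upwards [hopen] with q hq y hy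
    have : ψ q.1 y = q.2 := sub_eq_zero.1 hy
    rw [← this, hY2 _ hq]

end RadialInverse

/-! ### Radial gradients and uniqueness for the equation of motion. -/

/-- The gradient of a function of the distance to the origin. -/
lemma gradient_of_radial {V : Plane → ℝ} {U : ℝ → ℝ} (hV : ∀ x : Plane, x ≠ 0 → V x = U ‖x‖)
    (hU : ∀ r, 0 < r → DifferentiableAt ℝ U r) {x : Plane} (hx : x ≠ 0) :
    gradient V x = (deriv U ‖x‖ / ‖x‖) • x := by
  have hx' : 0 < ‖x‖ := norm_pos_iff.2 hx
  have hsq : HasFDerivAt (fun x : Plane => Real.sqrt (‖x‖ ^ 2))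
      ((1 / (2 * Real.sqrt (‖x‖ ^ 2))) • (2 • innerSL ℝ x)) x :=
    (hasStrictFDerivAt_norm_sq x).hasFDerivAt.sqrt (by positivity)
  have hn : HasFDerivAt (fun x : Plane => ‖x‖) ((1 / ‖x‖) • innerSL ℝ x) x := by
    have h1 : (fun x : Plane => Real.sqrt (‖x‖ ^ 2)) = fun x => ‖x‖ := by
      funext y; exact Real.sqrt_sq (norm_nonneg y)
    rw [h1] at hsq
    refine hsq.congr_fderiv ?_
    rw [Real.sqrt_sq hx'.le]
    ext y
    simp
    field_simp
  have hc := (hU _ hx').hasDerivAt.comp_hasFDerivAt x hn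
  have hV' : HasFDerivAt V (deriv U ‖x‖ • (1 / ‖x‖) • innerSL ℝ x) x := by
    refine hc.congr_of_eventuallyEq ?_
    filter_upwards [isOpen_ne.mem_nhds hx] with y hy using hV y hy
  refine HasGradientAt.gradient ?_
  rw [hasGradientAt_iff_hasFDerivAt]
  refine hV'.congr_fderiv ?_
  ext y
  simp
  ring

lemma contDiffAt_gradient {V : Plane → ℝ} {x : Plane} (hV : ContDiffAt ℝ ∞ V x) :
    ContDiffAt ℝ 1 (gradient V) x := by
  have h : ContDiffAt ℝ 1 (fderiv ℝ V) x := hV.fderiv_right (m := 1) (by norm_cast)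
  exact ((InnerProductSpace.toDual ℝ Plane).symm.toContinuousLinearEquiv.contDiff.contDiffAt).comp
    x h

/-- Two solutions of the Euler-Lagrange equation with the same position and velocity at one time
agree on every common interval. -/
theorem eulerLagrange_unique {V : Plane → ℝ} (hV : ∀ x : Plane, x ≠ 0 → ContDiffAt ℝ ∞ V x)
    {S : Set ℝ} (hS : IsOpen S) (hconn : IsPreconnected S) {γ δ : ℝ → Plane} {t₀ : ℝ}
    (ht₀ : t₀ ∈ S) (hγ0 : ∀ t ∈ S, γ t ≠ 0) (hγ1 : ∀ t ∈ S, DifferentiableAt ℝ γ t)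
    (hγ2 : ∀ t ∈ S, HasDerivAt (deriv γ) (-gradient V (γ t)) t)
    (hδ1 : ∀ t ∈ S, DifferentiableAt ℝ δ t)
    (hδ2 : ∀ t ∈ S, HasDerivAt (deriv δ) (-gradient V (δ t)) t)
    (h0 : γ t₀ = δ t₀) (h1 : deriv γ t₀ = deriv δ t₀) : EqOn γ δ S := by
  let F : ℝ → Plane × Plane := fun t => (γ t, deriv γ t)
  let D : ℝ → Plane × Plane := fun t => (δ t, deriv δ t)
  let v : Plane × Plane → Plane × Plane := fun z => (z.2, -gradient V z.1)
  have hF : ∀ t ∈ S, HasDerivAt F (v (F t)) t := fun t ht =>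
    (hγ1 t ht).hasDerivAt.prodMk (hγ2 t ht)
  have hD : ∀ t ∈ S, HasDerivAt D (v (D t)) t := fun t ht =>
    (hδ1 t ht).hasDerivAt.prodMk (hδ2 t ht)
  have hloc : ∀ t ∈ S, F t = D t → F =ᶠ[𝓝 t] D := by
    intro t ht heq
    have hv : ContDiffAt ℝ 1 v (F t) :=
      contDiffAt_snd.prodMk ((contDiffAt_gradient (hV _ (hγ0 t ht))).comp (F t)
        contDiffAt_fst).neg
    obtain ⟨K, s, hs, hK⟩ := hv.exists_lipschitzOnWith
    refine ODE_solution_unique_of_eventually (v := fun _ => v) (s := fun _ => s) (K := K)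
      (Eventually.of_forall fun _ => hK) ?_ ?_ heq
    · filter_upwards [hS.mem_nhds ht, (hF t ht).continuousAt hs] with u hu hu'
      exact ⟨hF u hu, hu'⟩
    · filter_upwards [hS.mem_nhds ht, (hD t ht).continuousAt (heq ▸ hs)] with u hu hu'
      exact ⟨hD u hu, hu'⟩
  -- The set of times of local agreement is open, and closed in `S` because agreement passes to
  -- limits and then spreads by `hloc`.
  have hsub : S ⊆ {t | F =ᶠ[𝓝 t] D} := by
    refine hconn.subset_of_closure_inter_subset isOpen_setOfPred_eventually_nhds
      ⟨t₀, ht₀, hloc t₀ ht₀ (Prod.ext h0 h1)⟩ ?_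
    rintro t ⟨htc, ht⟩
    refine hloc t ht ?_
    have hfr : ∃ᶠ u in 𝓝 t, F u = D u :=
      (mem_closure_iff_frequently.1 htc).mono fun u hu => hu.self_of_nhds
    exact tendsto_nhds_unique_of_frequently_eq (hF t ht).continuousAt (hD t ht).continuousAt hfr
  exact fun t ht => congrArg Prod.fst (hsub ht).self_of_nhds

/-! ### The deformed radius and its potential. -/

/-- The radius as a function of `ρ ∈ (-1, ∞)`. For `g = 0` we have `ρ = h r - 1`. -/
noncomputable def profileRadius (h : ℝ) (g : ℝ → ℝ) (ρ : ℝ) : ℝ :=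
  (1 + ρ) * Real.exp (g (ρ ^ 2)) / h

/-- The derivative of `profileRadius`. -/
noncomputable def profileRadiusDeriv (h : ℝ) (g : ℝ → ℝ) (ρ : ℝ) : ℝ :=
  Real.exp (g (ρ ^ 2)) * (1 + 2 * ρ * (1 + ρ) * deriv g (ρ ^ 2)) / h

/-- The radial potential `U` arises from the Kepler potential `-1 / r + h / 2` by the change of
the radial coordinate given by `g`. -/
structure IsKeplerDeformation (h : ℝ) (g U : ℝ → ℝ) : Prop where
  pos : 0 < h
  contDiff : ContDiff ℝ 1 g
  factor_pos : ∀ ρ, -1 ≤ ρ → 0 < 1 + 2 * ρ * (1 + ρ) * deriv g (ρ ^ 2)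
  differentiableAt : ∀ r, 0 < r → DifferentiableAt ℝ U r
  potential_eq : ∀ ρ, -1 < ρ → U (profileRadius h g ρ) =
    -(1 - ρ ^ 2) / (2 * h * profileRadius h g ρ ^ 2)
  exists_eq : ∀ r, 0 < r → ∃ ρ, -1 < ρ ∧ profileRadius h g ρ = r

namespace IsKeplerDeformation

variable {h : ℝ} {g U : ℝ → ℝ} (hg : IsKeplerDeformation h g U)
include hg

lemma hasDerivAt_g (c : ℝ) : HasDerivAt g (deriv g c) c :=
  (hg.contDiff.differentiable (by simp) c).hasDerivAt

lemma continuous_deriv_g : Continuous (deriv g) := hg.contDiff.continuous_deriv le_rfl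

lemma hasDerivAt_radius (ρ : ℝ) :
    HasDerivAt (profileRadius h g) (profileRadiusDeriv h g ρ) ρ := by
  have h1 := ((hg.hasDerivAt_g (ρ ^ 2)).comp ρ ((hasDerivAt_id ρ).pow 2)).exp
  refine ((((hasDerivAt_id ρ).const_add 1).mul h1).div_const h).congr_deriv ?_
  simp only [profileRadiusDeriv, Function.comp, id, Pi.pow_apply]
  push_cast
  ring

lemma continuous_radius : Continuous (profileRadius h g) :=
  continuous_iff_continuousAt.2 fun ρ => (hg.hasDerivAt_radius ρ).continuousAt

lemma continuous_radiusDeriv : Continuous (profileRadiusDeriv h g) := by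
  have := hg.continuous_deriv_g
  have := hg.contDiff.continuous
  unfold profileRadiusDeriv
  fun_prop

lemma radius_pos {ρ : ℝ} (hρ : -1 < ρ) : 0 < profileRadius h g ρ := by
  have := hg.pos
  have : 0 < 1 + ρ := by linarith
  unfold profileRadius
  positivity

lemma radiusDeriv_pos {ρ : ℝ} (hρ : -1 ≤ ρ) : 0 < profileRadiusDeriv h g ρ :=
  div_pos (mul_pos (Real.exp_pos _) (hg.factor_pos ρ hρ)) hg.pos

lemma strictMonoOn_radius : StrictMonoOn (profileRadius h g) (Ici (-1)) :=
  strictMonoOn_of_deriv_pos (convex_Ici _) hg.continuous_radius.continuousOn fun ρ hρ => by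
    rw [(hg.hasDerivAt_radius ρ).deriv]
    rw [interior_Ici] at hρ
    exact hg.radiusDeriv_pos (le_of_lt hρ)

/-- Both sides are the derivative of `U ∘ profileRadius` in `ρ`. The product form suffices, since
`clockRate` contains the same factor `profileRadiusDeriv`. -/
lemma deriv_potential_mul {ρ : ℝ} (hρ : -1 < ρ) :
    deriv U (profileRadius h g ρ) * profileRadiusDeriv h g ρ =
      ρ / (h * profileRadius h g ρ ^ 2) +
        (1 - ρ ^ 2) * profileRadiusDeriv h g ρ / (h * profileRadius h g ρ ^ 3) := by
  have hR := hg.radius_pos hρ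
  have hh := hg.pos
  have h1 := (hg.differentiableAt _ hR).hasDerivAt.comp ρ (hg.hasDerivAt_radius ρ)
  have hd : HasDerivAt (fun ρ => -(1 - ρ ^ 2) / (2 * h * profileRadius h g ρ ^ 2)) _ ρ :=
    ((((hasDerivAt_id ρ).pow 2).const_sub 1).neg).div
      (((hg.hasDerivAt_radius ρ).pow 2).const_mul (2 * h)) (by positivity)
  have h2 := hd.congr_of_eventuallyEq (f₁ := U ∘ profileRadius h g) (by
    filter_upwards [lt_mem_nhds hρ] with ρ hρ using hg.potential_eq ρ hρ)
  rw [h1.unique h2]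
  simp only [id, Pi.pow_apply, Pi.neg_apply]
  field_simp
  push_cast
  ring

end IsKeplerDeformation

/-! ### Time and eccentric anomaly. -/

/-- The coordinate `ρ` along the orbit of eccentricity `e`, as a function of the eccentric anomaly
`E`. -/
noncomputable def orbitRho (e E : ℝ) : ℝ := -(e * Real.cos E)

/-- The derivative of time with respect to the eccentric anomaly. -/
noncomputable def clockRate (h : ℝ) (g : ℝ → ℝ) (e E : ℝ) : ℝ :=
  Real.sqrt h * profileRadius h g (orbitRho e E) * profileRadiusDeriv h g (orbitRho e E)

/-- The time as a function of the eccentric anomaly. -/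
noncomputable def clock (h : ℝ) (g : ℝ → ℝ) (e E : ℝ) : ℝ := ∫ s in (0 : ℝ)..E, clockRate h g e s

lemma hasDerivAt_orbitRho (e E : ℝ) : HasDerivAt (orbitRho e) (e * Real.sin E) E :=
  ((Real.hasDerivAt_cos E).const_mul e).neg.congr_deriv (by ring)

lemma continuous_orbitRho (e : ℝ) : Continuous (orbitRho e) := by
  unfold orbitRho; fun_prop

lemma neg_one_le_orbitRho {e : ℝ} (he0 : 0 ≤ e) (he1 : e ≤ 1) (E : ℝ) : -1 ≤ orbitRho e E := by
  unfold orbitRho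
  nlinarith [Real.cos_le_one E]

lemma orbitRho_add_two_pi (e E : ℝ) : orbitRho e (E + 2 * Real.pi) = orbitRho e E := by
  simp [orbitRho]

lemma neg_one_lt_orbitRho {e : ℝ} (he0 : 0 ≤ e) (he1 : e ≤ 1) {E : ℝ} (hE : Real.cos E ≠ 1) :
    -1 < orbitRho e E := by
  have : Real.cos E < 1 := lt_of_le_of_ne (Real.cos_le_one E) hE
  unfold orbitRho
  rcases he0.eq_or_lt with rfl | he0
  · norm_num
  · nlinarith

lemma neg_one_lt_orbitRho_of_lt_one {e : ℝ} (he0 : 0 ≤ e) (he1 : e < 1) (E : ℝ) :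
    -1 < orbitRho e E := by
  unfold orbitRho
  nlinarith [Real.cos_le_one E]

lemma exists_mem_Icc_cos_ne_one {a b : ℝ} (hab : a < b) : ∃ c ∈ Icc a b, Real.cos c ≠ 1 := by
  by_contra! hcon
  obtain ⟨k, hk⟩ := (Real.cos_eq_one_iff a).1 (hcon a ⟨le_rfl, hab.le⟩)
  obtain ⟨d, hd0, hdb, hdπ⟩ : ∃ d, 0 < d ∧ d ≤ b - a ∧ d ≤ Real.pi :=
    ⟨min (b - a) Real.pi, lt_min (by linarith) Real.pi_pos, min_le_left _ _, min_le_right _ _⟩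
  have h1 := hcon (a + d) ⟨by linarith, by linarith⟩
  rw [← hk, add_comm, Real.cos_add_int_mul_two_pi] at h1
  have h2 := (Real.cos_eq_one_iff_of_lt_of_lt (by linarith [Real.pi_pos])
    (by linarith [Real.pi_pos])).1 h1
  linarith

namespace IsKeplerDeformation

variable {h : ℝ} {g U : ℝ → ℝ} (hg : IsKeplerDeformation h g U) {e : ℝ}
include hg

lemma continuous_clockRate (e : ℝ) : Continuous (clockRate h g e) := by
  have h1 := hg.continuous_radius.comp (continuous_orbitRho e)
  have h2 := hg.continuous_radiusDeriv.comp (continuous_orbitRho e)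
  exact (continuous_const.mul h1).mul h2

lemma clockRate_pos {E : ℝ} (hE : -1 < orbitRho e E) : 0 < clockRate h g e E :=
  mul_pos (mul_pos (Real.sqrt_pos.2 hg.pos) (hg.radius_pos hE)) (hg.radiusDeriv_pos hE.le)

lemma clockRate_nonneg (he0 : 0 ≤ e) (he1 : e ≤ 1) (E : ℝ) : 0 ≤ clockRate h g e E := by
  rcases (neg_one_le_orbitRho he0 he1 E).eq_or_lt with hE | hE
  · simp [clockRate, ← hE, profileRadius]
  · exact (hg.clockRate_pos hE).le

omit hg in
lemma periodic_clockRate : Function.Periodic (clockRate h g e) (2 * Real.pi) := fun E => by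
  simp [clockRate, orbitRho_add_two_pi]

lemma hasDerivAt_clock (e E : ℝ) : HasDerivAt (clock h g e) (clockRate h g e E) E :=
  intervalIntegral.integral_hasDerivAt_right ((hg.continuous_clockRate e).intervalIntegrable _ _)
    (hg.continuous_clockRate e).aestronglyMeasurable.stronglyMeasurableAtFilter
    (hg.continuous_clockRate e).continuousAt

/-- For `e = 1` the rate vanishes at the collisions, where `cos E = 1`; every nondegenerate interval
contains other points, so the clock is strictly increasing even there. -/
lemma integral_clockRate_pos (he0 : 0 ≤ e) (he1 : e ≤ 1) {a b : ℝ} (hab : a < b) :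
    0 < ∫ s in a..b, clockRate h g e s := by
  obtain ⟨c, hc, hc'⟩ := exists_mem_Icc_cos_ne_one hab
  exact intervalIntegral.integral_pos hab (hg.continuous_clockRate e).continuousOn
    (fun s _ => hg.clockRate_nonneg he0 he1 s)
    ⟨c, hc, hg.clockRate_pos (neg_one_lt_orbitRho he0 he1 hc')⟩

lemma strictMono_clock (he0 : 0 ≤ e) (he1 : e ≤ 1) : StrictMono (clock h g e) := by
  intro a b hab
  have h1 := hg.integral_clockRate_pos he0 he1 hab
  have h2 := intervalIntegral.integral_add_adjacent_intervals
    ((hg.continuous_clockRate e).intervalIntegrable (μ := MeasureTheory.volume) 0 a)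
    ((hg.continuous_clockRate e).intervalIntegrable a b)
  unfold clock
  linarith

lemma clock_add_two_pi (e E : ℝ) :
    clock h g e (E + 2 * Real.pi) = clock h g e E + clock h g e (2 * Real.pi) :=
  periodic_clockRate.intervalIntegral_add_eq_add 0 E
    (fun a b => (hg.continuous_clockRate e).intervalIntegrable a b) |>.trans (by
      simp [clock])

lemma clock_two_pi_pos (he0 : 0 ≤ e) (he1 : e ≤ 1) : 0 < clock h g e (2 * Real.pi) :=
  hg.integral_clockRate_pos he0 he1 Real.two_pi_pos

lemma surjective_clock (he0 : 0 ≤ e) (he1 : e ≤ 1) : Function.Surjective (clock h g e) := by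
  have hc : Continuous (clock h g e) :=
    continuous_iff_continuousAt.2 fun E => (hg.hasDerivAt_clock e E).continuousAt
  exact hc.surjective
    (periodic_clockRate.tendsto_atTop_intervalIntegral_of_pos (hg.clock_two_pi_pos he0 he1)
      Real.two_pi_pos)
    (periodic_clockRate.tendsto_atBot_intervalIntegral_of_pos (hg.clock_two_pi_pos he0 he1)
      Real.two_pi_pos)

/-- The eccentric anomaly as a function of time. -/
lemma exists_clock_inverse (he0 : 0 ≤ e) (he1 : e ≤ 1) :
    ∃ A : ℝ → ℝ, Continuous A ∧ StrictMono A ∧ (∀ t, clock h g e (A t) = t) ∧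
      (∀ E, A (clock h g e E) = E) ∧
      (∀ t, A (t + clock h g e (2 * Real.pi)) = A t + 2 * Real.pi) ∧
      ∀ t, -1 < orbitRho e (A t) → HasDerivAt A (clockRate h g e (A t))⁻¹ t := by
  let Φ := (hg.strictMono_clock he0 he1).orderIsoOfSurjective _ (hg.surjective_clock he0 he1)
  have h1 : ∀ t, clock h g e (Φ.symm t) = t := fun t => Φ.apply_symm_apply t
  have h2 : ∀ E, Φ.symm (clock h g e E) = E := fun E => Φ.symm_apply_apply E
  refine ⟨Φ.symm, Φ.symm.continuous, Φ.symm.strictMono, h1, h2, fun t => ?_, fun t ht => ?_⟩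
  · have := hg.clock_add_two_pi e (Φ.symm t)
    rw [h1] at this
    rw [← this, h2]
  -- The condition `-1 < ρ` excludes the collisions of `e = 1`, where the clock has derivative zero.
  · exact (hg.hasDerivAt_clock e _).of_local_left_inverse Φ.symm.continuous.continuousAt
      (hg.clockRate_pos ht).ne' (Eventually.of_forall h1)

end IsKeplerDeformation

/-! ### Polar angle, position and velocity along the explicit orbits. -/

/-- The rotation angle of the orbit of eccentricity `e` against the Kepler ellipse, as a function
of `y = e sin E`. -/
noncomputable def twistAngle (g : ℝ → ℝ) (e y : ℝ) : ℝ :=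
  ∫ u in (0 : ℝ)..y, -2 * Real.sqrt (1 - e ^ 2) * deriv g (e ^ 2 - u ^ 2)

/-- The difference between the action of the orbit of eccentricity `e` and the one of the Kepler
ellipse, as a function of `y = e sin E` and up to the factor `1 / √h`. -/
noncomputable def actionDefect (g : ℝ → ℝ) (e y : ℝ) : ℝ :=
  ∫ u in (0 : ℝ)..y, -2 * (1 - (e ^ 2 - u ^ 2)) * deriv g (e ^ 2 - u ^ 2)

/-- The cosine of the true anomaly of the Kepler ellipse. -/
noncomputable def keplerCos (e E : ℝ) : ℝ := (Real.cos E - e) / (1 + orbitRho e E)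

/-- The sine of the true anomaly of the Kepler ellipse. -/
noncomputable def keplerSin (e E : ℝ) : ℝ := Real.sqrt (1 - e ^ 2) * Real.sin E / (1 + orbitRho e E)

/-- The cosine of the polar angle along the orbit of eccentricity `e`. -/
noncomputable def orbitCos (g : ℝ → ℝ) (e E : ℝ) : ℝ :=
  keplerCos e E * Real.cos (twistAngle g e (e * Real.sin E)) -
    keplerSin e E * Real.sin (twistAngle g e (e * Real.sin E))

/-- The sine of the polar angle along the orbit of eccentricity `e`. -/
noncomputable def orbitSin (g : ℝ → ℝ) (e E : ℝ) : ℝ :=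
  keplerCos e E * Real.sin (twistAngle g e (e * Real.sin E)) +
    keplerSin e E * Real.cos (twistAngle g e (e * Real.sin E))

/-- The angular velocity with respect to the eccentric anomaly. -/
noncomputable def angleRate (h : ℝ) (g : ℝ → ℝ) (e E : ℝ) : ℝ :=
  Real.sqrt (1 - e ^ 2) * profileRadiusDeriv h g (orbitRho e E) / profileRadius h g (orbitRho e E)

/-- The radial unit vector along the orbit, in terms of an orthonormal basis `p`, `q`. -/
noncomputable def orbitDir (g : ℝ → ℝ) (e : ℝ) (p q : Plane) (E : ℝ) : Plane :=
  orbitCos g e E • p + orbitSin g e E • q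

/-- The angular unit vector along the orbit. -/
noncomputable def orbitNormal (g : ℝ → ℝ) (e : ℝ) (p q : Plane) (E : ℝ) : Plane :=
  -orbitSin g e E • p + orbitCos g e E • q

/-- The position along the orbit. -/
noncomputable def orbitPos (h : ℝ) (g : ℝ → ℝ) (e : ℝ) (p q : Plane) (E : ℝ) : Plane :=
  profileRadius h g (orbitRho e E) • orbitDir g e p q E

/-- The velocity along the orbit. -/
noncomputable def orbitVel (h : ℝ) (g : ℝ → ℝ) (e : ℝ) (p q : Plane) (E : ℝ) : Plane :=
  (e * Real.sin E / (Real.sqrt h * profileRadius h g (orbitRho e E))) • orbitDir g e p q E +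
    (Real.sqrt (1 - e ^ 2) / (Real.sqrt h * profileRadius h g (orbitRho e E))) •
      orbitNormal g e p q E

lemma norm_sq_smul_add_smul {F : Type*} [NormedAddCommGroup F] [InnerProductSpace ℝ F] {p q : F}
    (hp : ‖p‖ = 1) (hq : ‖q‖ = 1) (hpq : inner ℝ p q = 0) (x y : ℝ) :
    ‖x • p + y • q‖ ^ 2 = x ^ 2 + y ^ 2 := by
  rw [norm_add_sq_real, norm_smul, norm_smul, inner_smul_left, inner_smul_right, hp, hq, hpq]
  simp

section Direction

variable {h e : ℝ} {g : ℝ → ℝ} {E : ℝ}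

lemma sq_keplerCos_add_sq_keplerSin (he0 : 0 ≤ e) (he1 : e ≤ 1) (hE : -1 < orbitRho e E) :
    keplerCos e E ^ 2 + keplerSin e E ^ 2 = 1 := by
  have h1 : 1 + orbitRho e E ≠ 0 := by linarith
  have h2 := Real.sq_sqrt (show 0 ≤ 1 - e ^ 2 by nlinarith)
  have h3 := Real.sin_sq_add_cos_sq E
  unfold keplerCos keplerSin
  rw [div_pow, div_pow, ← add_div, div_eq_one_iff_eq (pow_ne_zero 2 h1), mul_pow, h2]
  unfold orbitRho
  linear_combination (1 - e ^ 2) * h3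

lemma sq_orbitCos_add_sq_orbitSin (he0 : 0 ≤ e) (he1 : e ≤ 1) (hE : -1 < orbitRho e E) :
    orbitCos g e E ^ 2 + orbitSin g e E ^ 2 = 1 := by
  have h1 := sq_keplerCos_add_sq_keplerSin he0 he1 hE
  have h2 := Real.sin_sq_add_cos_sq (twistAngle g e (e * Real.sin E))
  unfold orbitCos orbitSin
  linear_combination (keplerCos e E ^ 2 + keplerSin e E ^ 2) * h2 + h1

lemma hasDerivAt_keplerCos (he0 : 0 ≤ e) (he1 : e ≤ 1) (hE : -1 < orbitRho e E) :
    HasDerivAt (keplerCos e) (-(Real.sqrt (1 - e ^ 2) / (1 + orbitRho e E)) * keplerSin e E) E := by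
  have h1 : 1 + orbitRho e E ≠ 0 := by linarith
  have h2 := Real.sq_sqrt (show 0 ≤ 1 - e ^ 2 by nlinarith)
  refine (((Real.hasDerivAt_cos E).sub_const e).div ((hasDerivAt_orbitRho e E).const_add 1)
    h1).congr_deriv ?_
  unfold keplerSin
  field_simp
  rw [h2]
  unfold orbitRho
  ring

lemma hasDerivAt_keplerSin (hE : -1 < orbitRho e E) :
    HasDerivAt (keplerSin e) (Real.sqrt (1 - e ^ 2) / (1 + orbitRho e E) * keplerCos e E) E := by
  have h1 : 1 + orbitRho e E ≠ 0 := by linarith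
  have h3 := Real.sin_sq_add_cos_sq E
  refine (((Real.hasDerivAt_sin E).const_mul _).div ((hasDerivAt_orbitRho e E).const_add 1)
    h1).congr_deriv ?_
  unfold keplerCos
  field_simp
  unfold orbitRho
  linear_combination (-e * Real.sqrt (1 - e ^ 2)) * h3

lemma keplerCos_add_two_pi : keplerCos e (E + 2 * Real.pi) = keplerCos e E := by
  simp [keplerCos, orbitRho_add_two_pi]

lemma keplerSin_add_two_pi : keplerSin e (E + 2 * Real.pi) = keplerSin e E := by
  simp [keplerSin, orbitRho_add_two_pi]

lemma orbitPos_add_two_pi (p q : Plane) :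
    orbitPos h g e p q (E + 2 * Real.pi) = orbitPos h g e p q E := by
  simp [orbitPos, orbitDir, orbitCos, orbitSin, keplerCos_add_two_pi, keplerSin_add_two_pi,
    orbitRho_add_two_pi]

end Direction

lemma sq_sub_sq_mul_sin (e E : ℝ) : e ^ 2 - (e * Real.sin E) ^ 2 = orbitRho e E ^ 2 := by
  unfold orbitRho
  linear_combination (-e ^ 2) * Real.sin_sq_add_cos_sq E

namespace IsKeplerDeformation

variable {h : ℝ} {g U : ℝ → ℝ} (hg : IsKeplerDeformation h g U) {e E : ℝ} {p q : Plane}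
include hg

/-- Substituting `u = e sin E` turns `e² - u²` into `ρ²` and `du` into `-ρ dE`. Thus the odd part of
the angular rate has a primitive that depends on `sin E` alone, which is automatically periodic. -/
lemma hasDerivAt_twistAngle_comp :
    HasDerivAt (fun E => twistAngle g e (e * Real.sin E))
      (Real.sqrt (1 - e ^ 2) * (2 * orbitRho e E * deriv g (orbitRho e E ^ 2))) E := by
  have hc : Continuous fun u : ℝ => -2 * Real.sqrt (1 - e ^ 2) * deriv g (e ^ 2 - u ^ 2) := by
    have := hg.continuous_deriv_g
    fun_prop
  have h1 : HasDerivAt (twistAngle g e) _ (e * Real.sin E) :=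
    intervalIntegral.integral_hasDerivAt_right (hc.intervalIntegrable _ _)
      hc.aestronglyMeasurable.stronglyMeasurableAtFilter hc.continuousAt
  refine (h1.comp E ((Real.hasDerivAt_sin E).const_mul e)).congr_deriv ?_
  rw [sq_sub_sq_mul_sin]
  unfold orbitRho
  ring

lemma hasDerivAt_actionDefect_comp :
    HasDerivAt (fun E => actionDefect g e (e * Real.sin E))
      ((1 - orbitRho e E ^ 2) * (2 * orbitRho e E * deriv g (orbitRho e E ^ 2))) E := by
  have hc : Continuous fun u : ℝ =>
      -2 * (1 - (e ^ 2 - u ^ 2)) * deriv g (e ^ 2 - u ^ 2) := by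
    have := hg.continuous_deriv_g
    fun_prop
  have h1 : HasDerivAt (actionDefect g e) _ (e * Real.sin E) :=
    intervalIntegral.integral_hasDerivAt_right (hc.intervalIntegrable _ _)
      hc.aestronglyMeasurable.stronglyMeasurableAtFilter hc.continuousAt
  refine (h1.comp E ((Real.hasDerivAt_sin E).const_mul e)).congr_deriv ?_
  rw [sq_sub_sq_mul_sin]
  unfold orbitRho
  ring

/-- The logarithmic derivative splits into the Kepler term and a term odd in `ρ`; the Zoll property
rests on this oddness. -/
lemma radiusDeriv_div_radius {ρ : ℝ} (hρ : -1 < ρ) :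
    profileRadiusDeriv h g ρ / profileRadius h g ρ =
      1 / (1 + ρ) + 2 * ρ * deriv g (ρ ^ 2) := by
  have h1 : 1 + ρ ≠ 0 := by linarith
  have hh := hg.pos.ne'
  have := (Real.exp_pos (g (ρ ^ 2))).ne'
  unfold profileRadiusDeriv profileRadius
  field_simp

lemma angleRate_eq (hE : -1 < orbitRho e E) :
    angleRate h g e E = Real.sqrt (1 - e ^ 2) / (1 + orbitRho e E) +
      Real.sqrt (1 - e ^ 2) * (2 * orbitRho e E * deriv g (orbitRho e E ^ 2)) := by
  unfold angleRate
  rw [mul_div_assoc, hg.radiusDeriv_div_radius hE]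
  ring

lemma hasDerivAt_orbitCos (he0 : 0 ≤ e) (he1 : e ≤ 1) (hE : -1 < orbitRho e E) :
    HasDerivAt (orbitCos g e) (-(angleRate h g e E * orbitSin g e E)) E := by
  have hη := hg.hasDerivAt_twistAngle_comp (e := e) (E := E)
  refine (((hasDerivAt_keplerCos he0 he1 hE).mul hη.cos).sub
    ((hasDerivAt_keplerSin hE).mul hη.sin)).congr_deriv ?_
  rw [hg.angleRate_eq hE]
  unfold orbitSin
  ring

lemma hasDerivAt_orbitSin (he0 : 0 ≤ e) (he1 : e ≤ 1) (hE : -1 < orbitRho e E) :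
    HasDerivAt (orbitSin g e) (angleRate h g e E * orbitCos g e E) E := by
  have hη := hg.hasDerivAt_twistAngle_comp (e := e) (E := E)
  refine (((hasDerivAt_keplerCos he0 he1 hE).mul hη.sin).add
    ((hasDerivAt_keplerSin hE).mul hη.cos)).congr_deriv ?_
  rw [hg.angleRate_eq hE]
  unfold orbitCos
  ring

lemma hasDerivAt_orbitDir (he0 : 0 ≤ e) (he1 : e ≤ 1) (hE : -1 < orbitRho e E) :
    HasDerivAt (orbitDir g e p q) (angleRate h g e E • orbitNormal g e p q E) E := by
  refine (((hg.hasDerivAt_orbitCos he0 he1 hE).smul_const p).add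
    ((hg.hasDerivAt_orbitSin he0 he1 hE).smul_const q)).congr_deriv ?_
  unfold orbitNormal
  module

lemma hasDerivAt_orbitNormal (he0 : 0 ≤ e) (he1 : e ≤ 1) (hE : -1 < orbitRho e E) :
    HasDerivAt (orbitNormal g e p q) (-(angleRate h g e E) • orbitDir g e p q E) E := by
  refine (((hg.hasDerivAt_orbitSin he0 he1 hE).neg.smul_const p).add
    ((hg.hasDerivAt_orbitCos he0 he1 hE).smul_const q)).congr_deriv ?_
  unfold orbitDir
  module

lemma hasDerivAt_orbitRadius :
    HasDerivAt (fun E => profileRadius h g (orbitRho e E))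
      (profileRadiusDeriv h g (orbitRho e E) * (e * Real.sin E)) E :=
  (hg.hasDerivAt_radius _).comp E (hasDerivAt_orbitRho e E)

lemma hasDerivAt_orbitPos (he0 : 0 ≤ e) (he1 : e ≤ 1) (hE : -1 < orbitRho e E) :
    HasDerivAt (orbitPos h g e p q) (clockRate h g e E • orbitVel h g e p q E) E := by
  have hR := (hg.radius_pos hE).ne'
  have hs := (Real.sqrt_pos.2 hg.pos).ne'
  refine (hg.hasDerivAt_orbitRadius.smul (hg.hasDerivAt_orbitDir he0 he1 hE)).congr_deriv ?_
  unfold orbitVel clockRate angleRate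
  match_scalars <;> field_simp

/-- The components along `orbitNormal` cancel, which is conservation of angular momentum. The radial
component matches `deriv_potential_mul` because `(1 - e²) + (e sin E)² = 1 - ρ²`. -/
lemma hasDerivAt_orbitVel (he0 : 0 ≤ e) (he1 : e ≤ 1) (hE : -1 < orbitRho e E) :
    HasDerivAt (orbitVel h g e p q)
      (clockRate h g e E • -(deriv U (profileRadius h g (orbitRho e E)) • orbitDir g e p q E)) E := by
  have hR := (hg.radius_pos hE).ne'
  have hs := (Real.sqrt_pos.2 hg.pos).ne'
  have hh := Real.sq_sqrt hg.pos.le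
  have h2 := Real.sq_sqrt (show 0 ≤ 1 - e ^ 2 by nlinarith)
  have hU := hg.deriv_potential_mul hE
  have hden := hg.hasDerivAt_orbitRadius (e := e) (E := E) |>.const_mul (Real.sqrt h)
  refine (((((Real.hasDerivAt_sin E).const_mul e).div hden (mul_ne_zero hs hR)).smul
    (hg.hasDerivAt_orbitDir he0 he1 hE)).add
    (((hasDerivAt_const E (Real.sqrt (1 - e ^ 2))).div hden (mul_ne_zero hs hR)).smul
    (hg.hasDerivAt_orbitNormal he0 he1 hE))).congr_deriv ?_
  have hU' : clockRate h g e E * deriv U (profileRadius h g (orbitRho e E)) =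
      Real.sqrt h * profileRadius h g (orbitRho e E) *
      (orbitRho e E / (h * profileRadius h g (orbitRho e E) ^ 2) +
        (1 - orbitRho e E ^ 2) * profileRadiusDeriv h g (orbitRho e E) /
          (h * profileRadius h g (orbitRho e E) ^ 3)) := by
    rw [← hU]; unfold clockRate; ring
  rw [smul_neg, smul_smul (clockRate h g e E), hU']
  simp only [Pi.div_apply]
  unfold angleRate
  have hρ : orbitRho e E = -(e * Real.cos E) := rfl
  have h3 := Real.sin_sq_add_cos_sq E
  generalize profileRadius h g (orbitRho e E) = R at *
  generalize profileRadiusDeriv h g (orbitRho e E) = R' at *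
  rw [hρ]
  generalize Real.sqrt h = s at *
  generalize Real.sqrt (1 - e ^ 2) = j at *
  subst hh
  match_scalars
  · field_simp
    ring
  · field_simp
    linear_combination (-e ^ 2 * R') * h3 - R' * h2

omit hg in
lemma norm_orbitDir (he0 : 0 ≤ e) (he1 : e ≤ 1) (hE : -1 < orbitRho e E)
    (hp : ‖p‖ = 1) (hq : ‖q‖ = 1) (hpq : inner ℝ p q = 0) : ‖orbitDir g e p q E‖ = 1 := by
  have h1 := norm_sq_smul_add_smul hp hq hpq (orbitCos g e E) (orbitSin g e E)
  rw [sq_orbitCos_add_sq_orbitSin he0 he1 hE] at h1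
  exact (pow_eq_one_iff_of_nonneg (norm_nonneg _) two_ne_zero).1 h1

lemma norm_orbitPos (he0 : 0 ≤ e) (he1 : e ≤ 1) (hE : -1 < orbitRho e E)
    (hp : ‖p‖ = 1) (hq : ‖q‖ = 1) (hpq : inner ℝ p q = 0) :
    ‖orbitPos h g e p q E‖ = profileRadius h g (orbitRho e E) := by
  rw [orbitPos, norm_smul, norm_orbitDir he0 he1 hE hp hq hpq, mul_one, Real.norm_eq_abs,
    abs_of_pos (hg.radius_pos hE)]

lemma norm_sq_orbitVel (he0 : 0 ≤ e) (he1 : e ≤ 1) (hE : -1 < orbitRho e E)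
    (hp : ‖p‖ = 1) (hq : ‖q‖ = 1) (hpq : inner ℝ p q = 0) :
    ‖orbitVel h g e p q E‖ ^ 2 =
      (1 - orbitRho e E ^ 2) / (h * profileRadius h g (orbitRho e E) ^ 2) := by
  have hR := (hg.radius_pos hE).ne'
  have hs := (Real.sqrt_pos.2 hg.pos).ne'
  have hh := Real.sq_sqrt hg.pos.le
  have h2 := Real.sq_sqrt (show 0 ≤ 1 - e ^ 2 by nlinarith)
  have h3 := Real.sin_sq_add_cos_sq E
  have h1 := sq_orbitCos_add_sq_orbitSin (g := g) he0 he1 hE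
  have hv : ∀ a b : ℝ, a • orbitDir g e p q E + b • orbitNormal g e p q E =
      (a * orbitCos g e E - b * orbitSin g e E) • p +
        (a * orbitSin g e E + b * orbitCos g e E) • q := by
    intro a b
    unfold orbitDir orbitNormal
    module
  rw [orbitVel, hv, norm_sq_smul_add_smul hp hq hpq]
  have h4 : ∀ a b : ℝ, (a * orbitCos g e E - b * orbitSin g e E) ^ 2 +
      (a * orbitSin g e E + b * orbitCos g e E) ^ 2 = a ^ 2 + b ^ 2 := by
    intro a b
    linear_combination (a ^ 2 + b ^ 2) * h1
  rw [h4, div_pow, div_pow, ← add_div, mul_pow (Real.sqrt h), hh, h2, orbitRho]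
  congr 1
  linear_combination e ^ 2 * h3

end IsKeplerDeformation

/-! ### The explicit orbits: exhaustion, period and length. -/

/-- The orientation of `q` is left free so that `b ≥ 0` can be arranged: the explicit orbits have
angular momentum `√(1 - e²) / √h ≥ 0` in their own frame. -/
lemma exists_orthonormal_decomposition {x : Plane} (hx : x ≠ 0) (v : Plane) :
    ∃ (p q : Plane) (a b : ℝ), ‖p‖ = 1 ∧ ‖q‖ = 1 ∧ inner ℝ p q = 0 ∧ x = ‖x‖ • p ∧ 0 ≤ b ∧
      v = a • p + b • q := by
  have hx' : ‖x‖ ≠ 0 := norm_ne_zero_iff.2 hx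
  have hsq : ‖x‖ ^ 2 = x 0 ^ 2 + x 1 ^ 2 := by
    simp [EuclideanSpace.norm_sq_eq]
  have hgen : ∀ σ : ℝ, σ ^ 2 = 1 → 0 ≤ σ * (x 0 * v 1 - x 1 * v 0) →
      ∃ (p q : Plane) (a b : ℝ), ‖p‖ = 1 ∧ ‖q‖ = 1 ∧ inner ℝ p q = 0 ∧ x = ‖x‖ • p ∧ 0 ≤ b ∧
        v = a • p + b • q := by
    intro σ hσ hb
    refine ⟨!₂[x 0 / ‖x‖, x 1 / ‖x‖], !₂[-(σ * x 1) / ‖x‖, σ * x 0 / ‖x‖],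
      (x 0 * v 0 + x 1 * v 1) / ‖x‖, σ * (x 0 * v 1 - x 1 * v 0) / ‖x‖, ?_, ?_, ?_, ?_, ?_, ?_⟩
    · rw [← pow_eq_one_iff_of_nonneg (norm_nonneg _) two_ne_zero, EuclideanSpace.norm_sq_eq]
      simp only [Fin.sum_univ_two, Real.norm_eq_abs, sq_abs]
      simp only [Matrix.cons_val_zero, Matrix.cons_val_one]
      field_simp
      linear_combination -hsq
    · rw [← pow_eq_one_iff_of_nonneg (norm_nonneg _) two_ne_zero, EuclideanSpace.norm_sq_eq]
      simp only [Fin.sum_univ_two, Real.norm_eq_abs, sq_abs]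
      simp only [Matrix.cons_val_zero, Matrix.cons_val_one]
      field_simp
      linear_combination -hsq + (x 0 ^ 2 + x 1 ^ 2) * hσ
    · simp [PiLp.inner_apply, Fin.sum_univ_two]
      field_simp
      ring
    · ext i
      fin_cases i <;> simp <;> field_simp
    · positivity
    · ext i
      fin_cases i
      · simp
        field_simp
        linear_combination v 0 * hsq + (x 1 * (x 0 * v 1 - x 1 * v 0)) * hσ
      · simp
        field_simp
        linear_combination v 1 * hsq - (x 0 * (x 0 * v 1 - x 1 * v 0)) * hσ
  rcases le_total 0 (x 0 * v 1 - x 1 * v 0) with hs | hs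
  · exact hgen 1 (by norm_num) (by simpa using hs)
  · exact hgen (-1) (by norm_num) (by linarith)

namespace IsKeplerDeformation

variable {h : ℝ} {g U : ℝ → ℝ} (hg : IsKeplerDeformation h g U) {e : ℝ} {p q : Plane}
  {V : Plane → ℝ} {A : ℝ → ℝ}
include hg

/-- Every point of the zero energy level lies on one of the explicit orbits. -/
lemma exists_orbit_through (hV : ∀ x : Plane, x ≠ 0 → V x = U ‖x‖) {x v : Plane} (hx : x ≠ 0)
    (hE : energy V x v = 0) :
    ∃ (e E : ℝ) (p q : Plane), 0 ≤ e ∧ e ≤ 1 ∧ -1 < orbitRho e E ∧ ‖p‖ = 1 ∧ ‖q‖ = 1 ∧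
      inner ℝ p q = 0 ∧ orbitPos h g e p q E = x ∧ orbitVel h g e p q E = v := by
  obtain ⟨e₁, e₂, a, b, h1, h2, h12, hxe, hb, rfl⟩ := exists_orthonormal_decomposition hx v
  have hr : 0 < ‖x‖ := norm_pos_iff.2 hx
  obtain ⟨ρ, hρ, hRρ⟩ := hg.exists_eq _ hr
  have hh := hg.pos
  have hs := Real.sqrt_pos.2 hh
  have hss := Real.sq_sqrt hh.le
  rw [energy, hV x hx, norm_sq_smul_add_smul h1 h2 h12, ← hRρ, hg.potential_eq ρ hρ, hRρ] at hE
  have hE' : h * ‖x‖ ^ 2 * (a ^ 2 + b ^ 2) = 1 - ρ ^ 2 := by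
    field_simp at hE
    linarith
  -- The polar form of `w` supplies the orbit: `e = ‖w‖` and `E = arg w` solve `e cos E = -ρ` and `e
  -- sin E = √h r a`, where `a` is the radial velocity. The energy equation gives `e ≤ 1`.
  let w : ℂ := ⟨-ρ, Real.sqrt h * ‖x‖ * a⟩
  have hw : ‖w‖ ^ 2 = ρ ^ 2 + h * ‖x‖ ^ 2 * a ^ 2 := by
    rw [Complex.sq_norm, Complex.normSq_apply]
    simp only [w]
    linear_combination ‖x‖ ^ 2 * a ^ 2 * hss
  have hw1 : 1 - ‖w‖ ^ 2 = (Real.sqrt h * ‖x‖ * b) ^ 2 := by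
    rw [hw, mul_pow, mul_pow, hss]
    linarith
  have hcos : ‖w‖ * Real.cos w.arg = -ρ := Complex.norm_mul_cos_arg w
  have hsin : ‖w‖ * Real.sin w.arg = Real.sqrt h * ‖x‖ * a := Complex.norm_mul_sin_arg w
  have hwle : ‖w‖ ≤ 1 := by
    have : 0 ≤ 1 - ‖w‖ ^ 2 := hw1 ▸ sq_nonneg _
    nlinarith [norm_nonneg w]
  have hrho : orbitRho ‖w‖ w.arg = ρ := by rw [orbitRho, hcos, neg_neg]
  have hrho' : -1 < orbitRho ‖w‖ w.arg := by rwa [hrho]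
  have hsqrt : Real.sqrt (1 - ‖w‖ ^ 2) = Real.sqrt h * ‖x‖ * b := by
    rw [hw1, Real.sqrt_sq (by positivity)]
  have hXY := sq_orbitCos_add_sq_orbitSin (g := g) (norm_nonneg w) hwle hrho'
  set X := orbitCos g ‖w‖ w.arg
  set Y := orbitSin g ‖w‖ w.arg
  have h21 : inner ℝ e₂ e₁ = 0 := by rw [real_inner_comm]; exact h12
  -- The frame is `e₁, e₂` rotated back by the polar angle at `E`, so that the orbit points along
  -- `e₁` at that moment.
  have hdir : orbitDir g ‖w‖ (X • e₁ + (-Y) • e₂) (Y • e₁ + X • e₂) w.arg = e₁ := by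
    change X • (X • e₁ + (-Y) • e₂) + Y • (Y • e₁ + X • e₂) = e₁
    have : X • (X • e₁ + (-Y) • e₂) + Y • (Y • e₁ + X • e₂) = (X ^ 2 + Y ^ 2) • e₁ := by module
    rw [this, hXY, one_smul]
  have hnor : orbitNormal g ‖w‖ (X • e₁ + (-Y) • e₂) (Y • e₁ + X • e₂) w.arg = e₂ := by
    change -Y • (X • e₁ + (-Y) • e₂) + X • (Y • e₁ + X • e₂) = e₂
    have : -Y • (X • e₁ + (-Y) • e₂) + X • (Y • e₁ + X • e₂) = (X ^ 2 + Y ^ 2) • e₂ := by module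
    rw [this, hXY, one_smul]
  refine ⟨‖w‖, w.arg, X • e₁ + (-Y) • e₂, Y • e₁ + X • e₂, norm_nonneg w, hwle, hrho', ?_, ?_,
    ?_, ?_, ?_⟩
  · rw [← pow_eq_one_iff_of_nonneg (norm_nonneg _) two_ne_zero, norm_sq_smul_add_smul h1 h2 h12]
    linarith
  · rw [← pow_eq_one_iff_of_nonneg (norm_nonneg _) two_ne_zero, norm_sq_smul_add_smul h1 h2 h12]
    linarith
  · simp only [inner_add_left, inner_add_right, inner_smul_left, inner_smul_right, h12, h21,
      real_inner_self_eq_norm_sq, h1, h2]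
    simp
    ring
  · rw [orbitPos, hdir, hrho, hRρ, ← hxe]
  · rw [orbitVel, hdir, hnor, hrho, hRρ, hsin, hsqrt]
    congr 2 <;> field_simp

/-- The explicit curves are orbits. -/
lemma isZeroEnergyOrbit (hV : ∀ x : Plane, x ≠ 0 → V x = U ‖x‖) (he0 : 0 ≤ e) (he1 : e ≤ 1)
    (hp : ‖p‖ = 1) (hq : ‖q‖ = 1) (hpq : inner ℝ p q = 0)
    (hA' : ∀ t, -1 < orbitRho e (A t) → HasDerivAt A (clockRate h g e (A t))⁻¹ t) (c : ℝ)
    {S : Set ℝ} (hS : IsOpen S) (hSc : S.OrdConnected) (hSn : S.Nonempty)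
    (hSρ : ∀ t ∈ S, -1 < orbitRho e (A (t + c))) :
    IsZeroEnergyOrbit V S (fun t => orbitPos h g e p q (A (t + c))) ∧
      ∀ t ∈ S, deriv (fun t => orbitPos h g e p q (A (t + c))) t =
        orbitVel h g e p q (A (t + c)) := by
  have hAc : ∀ t ∈ S, HasDerivAt (fun t => A (t + c)) (clockRate h g e (A (t + c)))⁻¹ t :=
    fun t ht => (hA' _ (hSρ t ht)).comp_add_const t c
  have h1 : ∀ t ∈ S, HasDerivAt (fun t => orbitPos h g e p q (A (t + c)))
      (orbitVel h g e p q (A (t + c))) t := fun t ht => by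
    refine ((hg.hasDerivAt_orbitPos he0 he1 (hSρ t ht)).scomp t (hAc t ht)).congr_deriv ?_
    rw [smul_smul, inv_mul_cancel₀ (hg.clockRate_pos (hSρ t ht)).ne', one_smul]
  have hnorm : ∀ t ∈ S, ‖orbitPos h g e p q (A (t + c))‖ =
      profileRadius h g (orbitRho e (A (t + c))) := fun t ht =>
    hg.norm_orbitPos he0 he1 (hSρ t ht) hp hq hpq
  have hne : ∀ t ∈ S, orbitPos h g e p q (A (t + c)) ≠ 0 := fun t ht => by
    rw [← norm_pos_iff, hnorm t ht]
    exact hg.radius_pos (hSρ t ht)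
  refine ⟨⟨hS, hSc, hSn, hne, fun t ht => (h1 t ht).differentiableAt, fun t ht => ?_,
    fun t ht => ?_⟩, fun t ht => (h1 t ht).deriv⟩
  · have h2 : HasDerivAt (fun t => orbitVel h g e p q (A (t + c)))
        (-(deriv U (profileRadius h g (orbitRho e (A (t + c)))) •
          orbitDir g e p q (A (t + c)))) t := by
      refine ((hg.hasDerivAt_orbitVel he0 he1 (hSρ t ht)).scomp t (hAc t ht)).congr_deriv ?_
      rw [smul_smul, inv_mul_cancel₀ (hg.clockRate_pos (hSρ t ht)).ne', one_smul]
    have hgrad : gradient V (orbitPos h g e p q (A (t + c))) =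
        deriv U (profileRadius h g (orbitRho e (A (t + c)))) • orbitDir g e p q (A (t + c)) := by
      rw [gradient_of_radial hV hg.differentiableAt (hne t ht), hnorm t ht, orbitPos, smul_smul,
        div_mul_cancel₀ _ (hg.radius_pos (hSρ t ht)).ne']
    rw [hgrad]
    refine h2.congr_of_eventuallyEq ?_
    filter_upwards [hS.mem_nhds ht] with t ht using (h1 t ht).deriv
  · have hR := (hg.radius_pos (hSρ t ht)).ne'
    have hh := hg.pos.ne'
    rw [energy, (h1 t ht).deriv, hV _ (hne t ht), hnorm t ht,
      hg.norm_sq_orbitVel he0 he1 (hSρ t ht) hp hq hpq, hg.potential_eq _ (hSρ t ht)]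
    field_simp
    ring

/-- Along the explicit orbits of eccentricity `e < 1` the periods and lengths are as for the
Kepler ellipses. -/
lemma isMinimalPeriod_and_length_eq (hV : ∀ x : Plane, x ≠ 0 → V x = U ‖x‖) (he0 : 0 ≤ e)
    (he1 : e < 1) (hp : ‖p‖ = 1) (hq : ‖q‖ = 1) (hpq : inner ℝ p q = 0) (hA : Continuous A)
    (hAmono : StrictMono A) (hA0 : ∀ E, A (clock h g e E) = E)
    (hAper : ∀ t, A (t + clock h g e (2 * Real.pi)) = A t + 2 * Real.pi)
    (hA' : ∀ t, -1 < orbitRho e (A t) → HasDerivAt A (clockRate h g e (A t))⁻¹ t) (c : ℝ) :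
    IsMinimalPeriod (fun t => orbitPos h g e p q (A (t + c))) (clock h g e (2 * Real.pi)) ∧
      jacobiMaupertuisLength V (fun t => orbitPos h g e p q (A (t + c)))
        (clock h g e (2 * Real.pi)) = 2 * Real.pi / Real.sqrt h := by
  have hρ := neg_one_lt_orbitRho_of_lt_one he0 he1
  have hA00 : A 0 = 0 := by simpa [clock] using hA0 0
  refine ⟨⟨hg.clock_two_pi_pos he0 he1.le, fun t => ?_, fun s hs0 hsT hper => ?_⟩, ?_⟩
  · simp only
    rw [add_right_comm, hAper, orbitPos_add_two_pi]
  · have hAs0 : 0 < A s := hA00 ▸ hAmono hs0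
    have hAsT : A s < 2 * Real.pi := hA0 (2 * Real.pi) ▸ hAmono hsT
    have heq : orbitPos h g e p q (A s) = orbitPos h g e p q 0 := by
      -- At time `-c` the orbit is at the pericentre `E = 0`, the unique point of its kind in a
      -- turn.
      have := hper (-c)
      simp only at this
      rwa [neg_add_cancel, hA00, add_right_comm, neg_add_cancel, zero_add] at this
    have hcos : Real.cos (A s) = 1 := by
      -- On the circle `e = 0` the radius is constant, and the direction against `p` detects `cos
      -- E`; otherwise the radius does, being injective in `ρ`.
      rcases he0.eq_or_lt with rfl | he0
      · have hpos : ∀ E, inner ℝ p (orbitPos h g 0 p q E) = profileRadius h g 0 * Real.cos E := by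
          intro E
          simp [orbitPos, orbitDir, orbitCos, orbitSin, twistAngle, keplerCos, orbitRho,
            inner_add_right, inner_smul_right, hp, hpq]
        have h1 := congrArg (fun x => inner ℝ p x) heq
        simp only [hpos, Real.cos_zero] at h1
        exact mul_left_cancel₀ (hg.radius_pos (by norm_num)).ne' h1
      · have h1 := congrArg norm heq
        rw [hg.norm_orbitPos he0.le he1.le (hρ _) hp hq hpq,
          hg.norm_orbitPos he0.le he1.le (hρ _) hp hq hpq] at h1
        have h2 := hg.strictMonoOn_radius.injOn (hρ _).le (hρ _).le h1
        simp only [orbitRho, Real.cos_zero] at h2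
        exact mul_left_cancel₀ he0.ne' (neg_injective h2)
    have := (Real.cos_eq_one_iff_of_lt_of_lt (by linarith) hAsT).1 hcos
    linarith
  · obtain ⟨horb, hderiv⟩ := hg.isZeroEnergyOrbit hV he0 he1.le hp hq hpq hA' c isOpen_univ
      ordConnected_univ univ_nonempty fun t _ => hρ _
    have hh := hg.pos
    have hs := (Real.sqrt_pos.2 hh).ne'
    -- A primitive of the action density in `E`. All but the term `E / √h` is periodic, so one turn
    -- contributes `2π / √h`.
    let F : ℝ → ℝ := fun E =>
      (E + e * Real.sin E + actionDefect g e (e * Real.sin E)) / Real.sqrt h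
    let f : ℝ → ℝ := fun E =>
      (1 - orbitRho e E ^ 2) / (h * profileRadius h g (orbitRho e E) ^ 2)
    have hf : Continuous f := by
      refine Continuous.div ?_ ?_ fun E => ?_
      · exact continuous_const.sub ((continuous_orbitRho e).pow 2)
      · exact continuous_const.mul ((hg.continuous_radius.comp (continuous_orbitRho e)).pow 2)
      · have := hg.radius_pos (hρ E)
        positivity
    have hF : ∀ E, HasDerivAt F (clockRate h g e E * f E) E := by
      intro E
      refine ((((hasDerivAt_id E).add ((Real.hasDerivAt_sin E).const_mul e)).add
        hg.hasDerivAt_actionDefect_comp).div_const _).congr_deriv ?_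
      have hR := (hg.radius_pos (hρ E)).ne'
      have hρ' : 1 + orbitRho e E ≠ 0 := by linarith [hρ E]
      have h1 := hg.radiusDeriv_div_radius (hρ E)
      have h2 : clockRate h g e E * f E = (1 - orbitRho e E ^ 2) *
          (profileRadiusDeriv h g (orbitRho e E) / profileRadius h g (orbitRho e E)) /
            Real.sqrt h := by
        simp only [f, clockRate]
        nth_rw 4 [← Real.sq_sqrt hh.le]
        field_simp
      rw [h2, h1]
      have h3 : e * Real.cos E = -orbitRho e E := by simp [orbitRho]
      rw [h3]
      field_simp
      ring
    have hint : ∀ t, Real.sqrt (2 * (0 - V (orbitPos h g e p q (A (t + c))))) *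
        ‖deriv (fun t => orbitPos h g e p q (A (t + c))) t‖ = f (A (t + c)) := by
      intro t
      have hen := horb.energy_eq_zero t (mem_univ t)
      rw [energy] at hen
      have h1 : 2 * (0 - V (orbitPos h g e p q (A (t + c)))) =
          ‖deriv (fun t => orbitPos h g e p q (A (t + c))) t‖ ^ 2 := by linarith
      rw [h1, Real.sqrt_sq (norm_nonneg _), ← sq, hderiv t (mem_univ t),
        hg.norm_sq_orbitVel he0 he1.le (hρ _) hp hq hpq]
    have hFA : ∀ t, HasDerivAt (fun t => F (A (t + c))) (f (A (t + c))) t := by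
      intro t
      refine ((hF (A (t + c))).comp t ((hA' _ (hρ _)).comp_add_const t c)).congr_deriv ?_
      have := (hg.clockRate_pos (hρ (A (t + c)))).ne'
      field_simp
    unfold jacobiMaupertuisLength
    simp only [hint]
    rw [intervalIntegral.integral_eq_sub_of_hasDerivAt (fun t _ => hFA t)
      ((hf.comp (hA.comp (continuous_id.add continuous_const))).intervalIntegrable _ _),
      add_comm _ c, hAper, zero_add]
    simp only [F, Real.sin_add_two_pi]
    ring

end IsKeplerDeformation

/-! ### Maximal orbits, collisions and the Zoll property. -/

/-- An orbit which agrees at one time with another orbit agrees with it on the common interval. -/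
lemma IsZeroEnergyOrbit.eqOn {V : Plane → ℝ} (hV : ∀ x : Plane, x ≠ 0 → ContDiffAt ℝ ∞ V x)
    {I J : Set ℝ} {γ δ : ℝ → Plane} (hγ : IsZeroEnergyOrbit V I γ) (hδ : IsZeroEnergyOrbit V J δ)
    {t₀ : ℝ} (hI : t₀ ∈ I) (hJ : t₀ ∈ J) (h0 : γ t₀ = δ t₀) (h1 : deriv γ t₀ = deriv δ t₀) :
    EqOn γ δ (I ∩ J) :=
  eulerLagrange_unique hV (hγ.isOpen.inter hδ.isOpen)
    (hγ.ordConnected.inter hδ.ordConnected).isPreconnected ⟨hI, hJ⟩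
    (fun t ht => hγ.ne_zero t ht.1) (fun t ht => hγ.differentiableAt t ht.1)
    (fun t ht => hγ.eulerLagrange t ht.1) (fun t ht => hδ.differentiableAt t ht.2)
    (fun t ht => hδ.eulerLagrange t ht.2) h0 h1

/-- If on a bounded interval an orbit agrees with an orbit which runs into the origin at both
endpoints, and if it is maximal, then it is a collision trajectory. -/
lemma IsMaximalZeroEnergyOrbit.isCollision {V : Plane → ℝ} {I : Set ℝ} {γ δ : ℝ → Plane}
    {α β t₀ : ℝ} {B : ℝ → ℝ} (hγ : IsMaximalZeroEnergyOrbit V I γ)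
    (hδ : IsZeroEnergyOrbit V (Ioo α β) δ) (ht₀ : t₀ ∈ I) (ht₀' : t₀ ∈ Ioo α β)
    (heq : EqOn γ δ (I ∩ Ioo α β)) (hB : Continuous B) (hδB : ∀ t ∈ Ioo α β, ‖δ t‖ = B t)
    (hα : B α = 0) (hβ : B β = 0) : IsCollision I γ := by
  have hαβ : α < β := ht₀'.1.trans ht₀'.2
  -- By continuity `‖γ τ‖ = B τ` also at the endpoints, so an endpoint inside `I` would put `γ` at
  -- the origin.
  have hend : ∀ τ ∈ I, τ ∈ closure (Ioo α β) → B τ ≠ 0 := by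
    intro τ hτ hτ' hBτ
    have hcl : τ ∈ closure (I ∩ Ioo α β) := hγ.1.isOpen.inter_closure ⟨hτ, hτ'⟩
    have hfr : ∃ᶠ u in 𝓝 τ, ‖γ u‖ = B u :=
      (mem_closure_iff_frequently.1 hcl).mono fun u hu => by rw [heq hu, hδB u hu.2]
    have h1 := tendsto_nhds_unique_of_frequently_eq
      (hγ.1.differentiableAt τ hτ).continuousAt.norm.tendsto (hB.tendsto τ) hfr
    exact hγ.1.ne_zero τ hτ (norm_eq_zero.1 (h1.trans hBτ))
  rw [closure_Ioo hαβ.ne] at hend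
  have hsub : I ⊆ Ioo α β := by
    intro t ht
    by_contra hcon
    rcases le_or_gt t α with h1 | h1
    · exact hend α (hγ.1.ordConnected.out ht ht₀ ⟨h1, ht₀'.1.le⟩) ⟨le_rfl, hαβ.le⟩ hα
    · have h2 : β ≤ t := by
        by_contra! h2
        exact hcon ⟨h1, h2⟩
      exact hend β (hγ.1.ordConnected.out ht₀ ht ⟨ht₀'.2.le, h2⟩) ⟨hαβ.le, le_rfl⟩ hβ
  have heqI : EqOn γ δ I := fun t ht => heq ⟨ht, hsub ht⟩
  have hI : Ioo α β = I := hγ.2 _ _ hδ hsub heqI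
  refine ⟨β, ?_, ?_⟩
  · rw [← hI, closure_Ioo hαβ.ne]
    exact ⟨⟨hαβ.le, le_rfl⟩, fun hmem => lt_irrefl _ hmem.2⟩
  · rw [tendsto_zero_iff_norm_tendsto_zero]
    have h1 : Tendsto B (𝓝[I] β) (𝓝 0) := hβ ▸ (hB.tendsto β).mono_left nhdsWithin_le_nhds
    refine h1.congr' ?_
    filter_upwards [self_mem_nhdsWithin] with t ht
    rw [heqI ht, hδB t (hsub ht)]

/-- A potential obtained from the shifted Kepler potential by a deformation of the radial
coordinate is Zoll at zero energy. -/
theorem IsKeplerDeformation.isZollAtZeroEnergy {h : ℝ} {g U : ℝ → ℝ}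
    (hg : IsKeplerDeformation h g U) {V : Plane → ℝ} (hV : ∀ x : Plane, x ≠ 0 → V x = U ‖x‖)
    (hVs : ∀ x : Plane, x ≠ 0 → ContDiffAt ℝ ∞ V x) : IsZollAtZeroEnergy V := by
  constructor
  · obtain ⟨A, -, -, -, -, -, hA'⟩ := hg.exists_clock_inverse (e := 0) le_rfl zero_le_one
    obtain ⟨p, q, a, b, hp, hq, hpq, -⟩ := exists_orthonormal_decomposition
      (x := EuclideanSpace.single 0 1) (by simp) 0
    have horb := (hg.isZeroEnergyOrbit hV le_rfl zero_le_one hp hq hpq hA' 0 isOpen_univ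
      ordConnected_univ univ_nonempty fun t _ => by simp [orbitRho]).1
    -- The circular orbit `e = 0` is defined for all times, hence maximal, and `univ` has no finite
    -- endpoint.
    refine ⟨univ, _, ⟨horb, fun J δ _ hJ _ => univ_subset_iff.1 hJ⟩, ?_⟩
    rintro ⟨T, hT, -⟩
    exact hT.2 (mem_univ T)
  · refine ⟨2 * Real.pi / Real.sqrt h, div_pos Real.two_pi_pos (Real.sqrt_pos.2 hg.pos), ?_⟩
    intro I γ hγ hcol
    obtain ⟨t₀, ht₀⟩ := hγ.1.nonempty
    obtain ⟨e, E₀, p, q, he0, he1, hρ, hp, hq, hpq, hpos, hvel⟩ := hg.exists_orbit_through hV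
      (hγ.1.ne_zero t₀ ht₀) (hγ.1.energy_eq_zero t₀ ht₀)
    obtain ⟨A, hA, hAmono, hA1, hA2, hAper, hA'⟩ := hg.exists_clock_inverse he0 he1
    obtain ⟨c, hc⟩ : ∃ c, t₀ + c = clock h g e E₀ := ⟨clock h g e E₀ - t₀, by ring⟩
    have hAc : A (t₀ + c) = E₀ := by rw [hc, hA2]
    rcases he1.eq_or_lt with rfl | he1'
    · refine absurd ?_ hcol
      have hcos : Real.cos E₀ ≠ 1 := by
        intro h1
        simp [orbitRho, h1] at hρ
      -- For `e = 1` the collisions sit at multiples of `2π`; `k` selects the interval between two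
      -- consecutive ones that contains `E₀`.
      obtain ⟨k, hk1, hk2⟩ : ∃ k : ℤ, (k : ℝ) * (2 * Real.pi) < E₀ ∧
          E₀ < (k + 1) * (2 * Real.pi) := by
        refine ⟨⌊E₀ / (2 * Real.pi)⌋, lt_of_le_of_ne ?_ fun h1 => ?_, ?_⟩
        · exact (le_div_iff₀ Real.two_pi_pos).1 (Int.floor_le _)
        · exact hcos ((Real.cos_eq_one_iff _).2 ⟨_, h1⟩)
        · exact (div_lt_iff₀ Real.two_pi_pos).1 (Int.lt_floor_add_one _)
      have hcos' : ∀ E : ℝ, (k : ℝ) * (2 * Real.pi) < E → E < (k + 1) * (2 * Real.pi) →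
          Real.cos E ≠ 1 := by
        intro E h1 h2 h3
        have h4 : Real.cos (E - k * (2 * Real.pi)) = 1 := by
          rw [Real.cos_sub_int_mul_two_pi, h3]
        have h5 := (Real.cos_eq_one_iff_of_lt_of_lt (by linarith [Real.pi_pos])
          (by linarith)).1 h4
        linarith
      let α := clock h g 1 (k * (2 * Real.pi)) - c
      let β := clock h g 1 ((k + 1) * (2 * Real.pi)) - c
      have hAα : A (α + c) = k * (2 * Real.pi) := by simp only [α, sub_add_cancel, hA2]
      have hAβ : A (β + c) = (k + 1) * (2 * Real.pi) := by simp only [β, sub_add_cancel, hA2]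
      have hmem : ∀ t, t ∈ Ioo α β ↔ A (t + c) ∈
          Ioo ((k : ℝ) * (2 * Real.pi)) ((k + 1) * (2 * Real.pi)) := fun t => by
        rw [← hAα, ← hAβ, mem_Ioo, mem_Ioo, hAmono.lt_iff_lt, hAmono.lt_iff_lt,
          add_lt_add_iff_right, add_lt_add_iff_right]
      have hρ' : ∀ t ∈ Ioo α β, -1 < orbitRho 1 (A (t + c)) := fun t ht => by
        have ht' := (hmem t).1 ht
        exact neg_one_lt_orbitRho he0 he1 (hcos' _ ht'.1 ht'.2)
      have ht₀' : t₀ ∈ Ioo α β := (hmem t₀).2 (by rw [hAc]; exact ⟨hk1, hk2⟩)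
      obtain ⟨horb, hderiv⟩ := hg.isZeroEnergyOrbit hV he0 he1 hp hq hpq hA' c isOpen_Ioo
        ordConnected_Ioo ⟨t₀, ht₀'⟩ hρ'
      have hzero : ∀ E, Real.cos E = 1 → profileRadius h g (orbitRho 1 E) = 0 := fun E hE => by
        simp [orbitRho, hE, profileRadius]
      refine hγ.isCollision (B := fun t => profileRadius h g (orbitRho 1 (A (t + c)))) horb ht₀
        ht₀' ?_ ?_ ?_ ?_ ?_
      · exact hγ.1.eqOn hVs horb ht₀ ht₀' (by rw [hAc, hpos])
          (by rw [hderiv t₀ ht₀', hAc, hvel])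
      · exact hg.continuous_radius.comp ((continuous_orbitRho 1).comp
          (hA.comp (continuous_id.add continuous_const)))
      · exact fun t ht => hg.norm_orbitPos he0 he1 (hρ' t ht) hp hq hpq
      · simp only [hAα]
        exact hzero _ (Real.cos_int_mul_two_pi k)
      · simp only [hAβ]
        exact hzero _ (by exact_mod_cast Real.cos_int_mul_two_pi (k + 1))
    · obtain ⟨horb, hderiv⟩ := hg.isZeroEnergyOrbit hV he0 he1 hp hq hpq hA' c isOpen_univ
        ordConnected_univ univ_nonempty
        fun t _ => neg_one_lt_orbitRho_of_lt_one he0 he1' (A (t + c))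
      have heq := hγ.1.eqOn hVs horb ht₀ (mem_univ t₀) (by rw [hAc, hpos])
        (by rw [hderiv t₀ (mem_univ t₀), hAc, hvel])
      rw [inter_univ] at heq
      have hI : univ = I := hγ.2 _ _ horb (subset_univ I) heq
      have hγeq : γ = fun t => orbitPos h g e p q (A (t + c)) :=
        funext fun t => heq (hI ▸ mem_univ t)
      refine ⟨hI.symm, clock h g e (2 * Real.pi), ?_⟩
      rw [hγeq]
      exact hg.isMinimalPeriod_and_length_eq hV he0 he1' hp hq hpq hA hAmono hA2 hAper hA' c

/-! ### The family of potentials: smoothness, Hill region, injectivity, immersion. -/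

section Family

variable {E : Type*} [NormedAddCommGroup E] [NormedSpace ℝ E]

/-- The coordinate `ρ` as a function of the radius, for a given solution `Y` of the implicit
equation in the logarithmic coordinate. -/
noncomputable def radialRho (h : ℝ) (Y : E → ℝ → ℝ) (a : E) (r : ℝ) : ℝ :=
  Real.exp (Y a (Real.log (h * r))) - 1

/-- The deformed radial potential, written as a perturbation of the Kepler potential. -/
noncomputable def deformedRadialPotential (h : ℝ) (Y : E → ℝ → ℝ) (a : E) (r : ℝ) : ℝ :=
  -(1 / r) + h / 2 + (radialRho h Y a r ^ 2 - (h * r - 1) ^ 2) / (2 * h * r ^ 2)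

/-- The deformed potential on the plane. -/
noncomputable def deformedPotential (h : ℝ) (Y : E → ℝ → ℝ) (a : E) (x : Plane) : ℝ :=
  deformedRadialPotential h Y a ‖x‖

omit [NormedAddCommGroup E] [NormedSpace ℝ E] in
lemma neg_one_lt_radialRho {h : ℝ} {Y : E → ℝ → ℝ} (a : E) (r : ℝ) : -1 < radialRho h Y a r := by
  have := Real.exp_pos (Y a (Real.log (h * r)))
  unfold radialRho
  linarith

omit [NormedAddCommGroup E] [NormedSpace ℝ E] in
lemma deformedRadialPotential_eq {h : ℝ} {Y : E → ℝ → ℝ} (hh : 0 < h) (a : E) {r : ℝ} (hr : 0 < r) :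
    deformedRadialPotential h Y a r = -(1 - radialRho h Y a r ^ 2) / (2 * h * r ^ 2) := by
  unfold deformedRadialPotential
  field_simp
  ring

/-- `Y` solves the implicit equation for the logarithmic radial coordinate given by the family
`G`. -/
structure IsRadialInverse (G : ℝ → E →L[ℝ] ℝ) (Y : E → ℝ → ℝ) : Prop where
  apply_add : ∀ a, ‖a‖ < 1 → ∀ σ, Y a σ + G ((Real.exp (Y a σ) - 1) ^ 2) a = σ
  apply_log_radius : ∀ a, ‖a‖ < 1 → ∀ y, Y a (y + G ((Real.exp y - 1) ^ 2) a) = y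
  contDiffAt : ∀ a, ‖a‖ < 1 → ∀ σ, ContDiffAt ℝ ∞ (fun p : E × ℝ => Y p.1 p.2) (a, σ)

variable {h : ℝ} {G : ℝ → E →L[ℝ] ℝ} {Y : E → ℝ → ℝ}

lemma radialRho_profileRadius (hh : 0 < h) (hY : IsRadialInverse G Y) {a : E} (ha : ‖a‖ < 1)
    {ρ : ℝ} (hρ : -1 < ρ) :
    radialRho h Y a (profileRadius h (fun c => G c a) ρ) = ρ := by
  have h1 : 0 < 1 + ρ := by linarith
  have h2 := hY.apply_log_radius a ha (Real.log (1 + ρ))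
  rw [Real.exp_log h1, add_sub_cancel_left] at h2
  rw [radialRho, profileRadius, mul_div_cancel₀ _ hh.ne',
    Real.log_mul h1.ne' (Real.exp_pos _).ne', Real.log_exp, h2, Real.exp_log h1]
  ring

lemma profileRadius_radialRho (hh : 0 < h) (hY : IsRadialInverse G Y) {a : E} (ha : ‖a‖ < 1)
    {r : ℝ} (hr : 0 < r) :
    profileRadius h (fun c => G c a) (radialRho h Y a r) = r := by
  have h1 := hY.apply_add a ha (Real.log (h * r))
  rw [profileRadius, radialRho, add_sub_cancel, ← Real.exp_add, h1,
    Real.exp_log (mul_pos hh hr)]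
  field_simp

lemma contDiffAt_deformedRadialPotential (hh : 0 < h) (hY : IsRadialInverse G Y) {a : E}
    (ha : ‖a‖ < 1) {r : ℝ} (hr : 0 < r) :
    ContDiffAt ℝ ∞ (fun p : E × ℝ => deformedRadialPotential h Y p.1 p.2) (a, r) := by
  have hlog : ContDiffAt ℝ ∞ (fun p : E × ℝ => Real.log (h * p.2)) (a, r) :=
    (contDiffAt_const.mul contDiffAt_snd).log (mul_pos hh hr).ne'
  have hY' : ContDiffAt ℝ ∞ (fun p : E × ℝ => Y p.1 (Real.log (h * p.2))) (a, r) :=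
    ContDiffAt.comp (g := fun p : E × ℝ => Y p.1 p.2) (a, r) (hY.contDiffAt a ha (Real.log (h * r)))
      (contDiffAt_fst.prodMk hlog)
  have hρ : ContDiffAt ℝ ∞ (fun p : E × ℝ => radialRho h Y p.1 p.2) (a, r) :=
    hY'.exp.sub contDiffAt_const
  refine ((contDiffAt_const.div contDiffAt_snd hr.ne').neg.add contDiffAt_const).add
    (((hρ.pow 2).sub (((contDiffAt_const.mul contDiffAt_snd).sub contDiffAt_const).pow 2)).div
      (contDiffAt_const.mul (contDiffAt_snd.pow 2)) ?_)
  positivity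

lemma contDiffAt_deformedPotential (hh : 0 < h) (hY : IsRadialInverse G Y) {a : E}
    (ha : ‖a‖ < 1) {x : Plane} (hx : x ≠ 0) :
    ContDiffAt ℝ ∞ (fun p : E × Plane => deformedPotential h Y p.1 p.2) (a, x) :=
  ContDiffAt.comp (a, x) (contDiffAt_deformedRadialPotential hh hY ha (norm_pos_iff.2 hx))
    (contDiffAt_fst.prodMk (contDiffAt_snd.norm ℝ hx))

lemma contDiffAt_deformedRadialPotential_right (hh : 0 < h) (hY : IsRadialInverse G Y) {a : E}
    (ha : ‖a‖ < 1) {r : ℝ} (hr : 0 < r) : ContDiffAt ℝ ∞ (deformedRadialPotential h Y a) r :=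
  ContDiffAt.comp r (contDiffAt_deformedRadialPotential hh hY ha hr)
    (contDiffAt_const.prodMk contDiffAt_id)

lemma contDiffAt_deformedPotential_right (hh : 0 < h) (hY : IsRadialInverse G Y) {a : E}
    (ha : ‖a‖ < 1) {x : Plane} (hx : x ≠ 0) : ContDiffAt ℝ ∞ (deformedPotential h Y a) x :=
  (contDiffAt_deformedRadialPotential_right hh hY ha (norm_pos_iff.2 hx)).comp x
    (contDiffAt_norm ℝ hx)

lemma isKeplerDeformation (hh : 0 < h) (hG : ContDiff ℝ ∞ G) (hG0 : ∀ c, 1 ≤ c → G c = 0)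
    (hG1 : ∀ c, ‖deriv G c‖ ≤ 1 / 8) (hY : IsRadialInverse G Y) {a : E} (ha : ‖a‖ < 1) :
    IsKeplerDeformation h (fun c => G c a) (deformedRadialPotential h Y a) where
  pos := hh
  contDiff := (hG.clm_apply contDiff_const).of_le (by norm_cast)
  factor_pos := fun ρ hρ => by
    rw [(hasDerivAt_apply_of_contDiff hG a (ρ ^ 2)).deriv]
    exact lt_of_lt_of_le (by norm_num) (half_le_one_add_two_mul_deriv hG0 hG1 ha hρ)
  differentiableAt := fun r hr =>
    (contDiffAt_deformedRadialPotential_right hh hY ha hr).differentiableAt (by simp)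
  potential_eq := fun ρ hρ => by
    have hR : 0 < profileRadius h (fun c => G c a) ρ := by
      have : 0 < 1 + ρ := by linarith
      unfold profileRadius
      positivity
    rw [deformedRadialPotential_eq hh a hR, radialRho_profileRadius hh hY ha hρ]
  exists_eq := fun r hr =>
    ⟨_, neg_one_lt_radialRho a r, profileRadius_radialRho hh hY ha hr⟩

lemma deformedPotential_zero (hh : 0 < h) (hY : IsRadialInverse G Y) :
    deformedPotential h Y 0 = keplerPotential h := by
  funext x
  unfold deformedPotential deformedRadialPotential keplerPotential
  rcases (norm_nonneg x).eq_or_lt with hx | hx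
  -- At the origin both sides take the default value `h / 2`, since the perturbation is a quotient
  -- by zero. This is why the deformed potential is written as Kepler plus a correction.
  · simp [← hx]
  · have h1 := profileRadius_radialRho hh hY (a := 0) (by simp) hx
    simp only [profileRadius, map_zero, Real.exp_zero, mul_one] at h1
    have h2 : radialRho h Y 0 ‖x‖ = h * ‖x‖ - 1 := by
      rw [div_eq_iff hh.ne'] at h1
      linarith
    simp [h2]

lemma mem_hillRegion_keplerPotential (hh : 0 < h) {x : Plane} :
    x ∈ hillRegion (keplerPotential h) ↔ x ≠ 0 ∧ ‖x‖ ≤ 2 / h := by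
  refine and_congr_right fun hx => ?_
  have hx' : 0 < ‖x‖ := norm_pos_iff.2 hx
  rw [keplerPotential, le_div_iff₀ hh, neg_add_nonpos_iff, div_le_div_iff₀ two_pos hx', mul_comm,
    one_mul]

lemma profileRadius_one (hG0 : ∀ c, 1 ≤ c → G c = 0) (a : E) :
    profileRadius h (fun c => G c a) 1 = 2 / h := by
  rw [profileRadius, hG0 _ (by norm_num)]
  norm_num

/-- The potential has the sign of `ρ² - 1`, and `ρ > -1`, so it is nonpositive exactly for `ρ ≤ 1`.
The corresponding radius is `2 / h` because the family vanishes at `c = 1`. -/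
lemma hillRegion_deformedPotential (hh : 0 < h) (hG : ContDiff ℝ ∞ G)
    (hG0 : ∀ c, 1 ≤ c → G c = 0) (hG1 : ∀ c, ‖deriv G c‖ ≤ 1 / 8) (hY : IsRadialInverse G Y)
    {a : E} (ha : ‖a‖ < 1) :
    hillRegion (deformedPotential h Y a) = hillRegion (keplerPotential h) := by
  ext x
  rw [mem_hillRegion_keplerPotential hh]
  refine and_congr_right fun hx => ?_
  have hx' : 0 < ‖x‖ := norm_pos_iff.2 hx
  have hρ := neg_one_lt_radialRho (h := h) (Y := Y) a ‖x‖
  have hmono := (isKeplerDeformation hh hG hG0 hG1 hY ha).strictMonoOn_radius.le_iff_le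
    (a := radialRho h Y a ‖x‖) (b := 1) hρ.le (by norm_num)
  rw [profileRadius_radialRho hh hY ha hx', profileRadius_one hG0] at hmono
  rw [hmono, deformedPotential, deformedRadialPotential_eq hh a hx', neg_div, neg_nonpos,
    le_div_iff₀ (by positivity), zero_mul, sub_nonneg]
  constructor <;> intro h1 <;> nlinarith

/-- A point of the Hill region on the circle where `ρ = ρ₀`. -/
lemma exists_mem_hillRegion_norm_eq (hh : 0 < h) (hG : ContDiff ℝ ∞ G)
    (hG0 : ∀ c, 1 ≤ c → G c = 0) (hG1 : ∀ c, ‖deriv G c‖ ≤ 1 / 8) (hY : IsRadialInverse G Y)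
    {a : E} (ha : ‖a‖ < 1) {ρ : ℝ} (hρ : -1 < ρ) (hρ1 : ρ ≤ 1) :
    ∃ x ∈ hillRegion (keplerPotential h), ‖x‖ = profileRadius h (fun c => G c a) ρ := by
  have hk := isKeplerDeformation hh hG hG0 hG1 hY ha
  have hR := hk.radius_pos hρ
  have hnorm : ‖(EuclideanSpace.single 0 (profileRadius h (fun c => G c a) ρ) : Plane)‖ =
      profileRadius h (fun c => G c a) ρ := by
    rw [PiLp.norm_single, Real.norm_eq_abs, abs_of_pos hR]
  refine ⟨_, (mem_hillRegion_keplerPotential hh).2 ⟨?_, ?_⟩, hnorm⟩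
  · rw [← norm_pos_iff, hnorm]
    exact hR
  · rw [hnorm, ← profileRadius_one hG0 a]
    exact hk.strictMonoOn_radius.monotoneOn hρ.le (by norm_num) hρ1

/-- At each radius in the Hill region equal potentials have equal `ρ²`. Both functions `ρ` vanish at
the same radius and increase with `r`, so they have equal signs too; equality of `ρ` then forces `G
c a = G c b` for every `c` in `(0, 1)`. -/
lemma eq_of_equivalentPotentials (hh : 0 < h) (hG : ContDiff ℝ ∞ G)
    (hG0 : ∀ c, 1 ≤ c → G c = 0) (hG1 : ∀ c, ‖deriv G c‖ ≤ 1 / 8)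
    (hG2 : ∀ b, b ≠ 0 → ∃ c ∈ Ioo (0 : ℝ) 1, G c b ≠ 0) (hY : IsRadialInverse G Y)
    {a b : E} (ha : ‖a‖ < 1) (hb : ‖b‖ < 1)
    (heq : EquivalentPotentials h (deformedPotential h Y a) (deformedPotential h Y b)) :
    a = b := by
  by_contra hab
  obtain ⟨c, hc, hcab⟩ := hG2 (a - b) (sub_ne_zero.2 hab)
  have hka := isKeplerDeformation hh hG hG0 hG1 hY ha
  have hkb := isKeplerDeformation hh hG hG0 hG1 hY hb
  have key : ∀ ρ, -1 < ρ → ρ ≤ 1 →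
      radialRho h Y b (profileRadius h (fun c => G c a) ρ) ^ 2 = ρ ^ 2 := by
    intro ρ hρ hρ1
    obtain ⟨x, hx, hxn⟩ := exists_mem_hillRegion_norm_eq hh hG hG0 hG1 hY ha hρ hρ1
    have h1 := heq hx
    have hR := hka.radius_pos hρ
    rw [deformedPotential, deformedPotential, hxn, deformedRadialPotential_eq hh a hR,
      deformedRadialPotential_eq hh b hR, radialRho_profileRadius hh hY ha hρ] at h1
    rw [div_left_inj' (by positivity)] at h1
    linarith
  have hzero : profileRadius h (fun c => G c a) 0 = profileRadius h (fun c => G c b) 0 := by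
    have h1 := key 0 (by norm_num) zero_le_one
    rw [zero_pow two_ne_zero, sq_eq_zero_iff] at h1
    rw [← h1, profileRadius_radialRho hh hY hb (hka.radius_pos (by norm_num))]
    rw [h1]
  have hs0 : 0 < Real.sqrt c := Real.sqrt_pos.2 hc.1
  have hs1 : Real.sqrt c < 1 := by
    rw [Real.sqrt_lt' one_pos, one_pow]
    exact hc.2
  have hR := hka.radius_pos (ρ := Real.sqrt c) (by linarith)
  have hinv := profileRadius_radialRho hh hY hb hR
  rcases sq_eq_sq_iff_eq_or_eq_neg.1 (key (Real.sqrt c) (by linarith) hs1.le) with h1 | h1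
  · rw [h1, profileRadius, profileRadius, Real.sq_sqrt hc.1.le, div_left_inj' hh.ne',
      mul_right_inj' (by linarith), Real.exp_eq_exp] at hinv
    exact hcab (by rw [map_sub, hinv, sub_self])
  -- The opposite sign would place this one radius both below and above the common radius where `ρ =
  -- 0`.
  · rw [h1] at hinv
    have h2 := hkb.strictMonoOn_radius (a := -Real.sqrt c) (b := 0)
      (by simpa using hs1.le) (by norm_num) (by linarith)
    have h3 := hka.strictMonoOn_radius (a := 0) (b := Real.sqrt c) (by norm_num)
      (by rw [mem_Ici]; linarith) hs0
    rw [hinv, ← hzero] at h2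
    exact lt_asymm h2 h3

/-- Test at the radius where `ρ = √c` with `G c b ≠ 0`. As `ρ ≠ 0` there, a vanishing derivative of
`ρ²` means that `Y` itself is stationary in the direction `b`; differentiating the implicit equation
then leaves `G c b = 0`. -/
lemma exists_fderiv_deformedPotential_ne_zero (hh : 0 < h) (hG : ContDiff ℝ ∞ G)
    (hG0 : ∀ c, 1 ≤ c → G c = 0) (hG1 : ∀ c, ‖deriv G c‖ ≤ 1 / 8)
    (hG2 : ∀ b, b ≠ 0 → ∃ c ∈ Ioo (0 : ℝ) 1, G c b ≠ 0) (hY : IsRadialInverse G Y)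
    {a b : E} (ha : ‖a‖ < 1) (hb : b ≠ 0) :
    ∃ x ∈ hillRegion (keplerPotential h), x ≠ 0 ∧
      fderiv ℝ (fun a' => deformedPotential h Y a' x) a b ≠ 0 := by
  obtain ⟨c, hc, hcb⟩ := hG2 b hb
  have hs0 : 0 < Real.sqrt c := Real.sqrt_pos.2 hc.1
  have hs1 : Real.sqrt c < 1 := by
    rw [Real.sqrt_lt' one_pos, one_pow]
    exact hc.2
  obtain ⟨x, hx, hxn⟩ := exists_mem_hillRegion_norm_eq hh hG hG0 hG1 hY ha
    (ρ := Real.sqrt c) (by linarith) hs1.le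
  have hx' : 0 < ‖x‖ := norm_pos_iff.2 hx.1
  refine ⟨x, hx, hx.1, fun hcon => hcb ?_⟩
  have hρ : radialRho h Y a ‖x‖ = Real.sqrt c := by
    rw [hxn, radialRho_profileRadius hh hY ha (by linarith)]
  have hline : HasDerivAt (fun s : ℝ => a + s • b) b 0 := by
    simpa using ((hasDerivAt_id (0 : ℝ)).smul_const b).const_add a
  have hline0 : a + (0 : ℝ) • b = a := by simp
  have hYd : DifferentiableAt ℝ (fun a' => Y a' (Real.log (h * ‖x‖))) a :=
    (ContDiffAt.comp (g := fun p : E × ℝ => Y p.1 p.2) a (hY.contDiffAt a ha (Real.log (h * ‖x‖)))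
      (contDiffAt_id.prodMk contDiffAt_const)).differentiableAt (by simp)
  have hΦd : DifferentiableAt ℝ (fun a' => deformedPotential h Y a' x) a :=
    (ContDiffAt.comp (g := fun p : E × Plane => deformedPotential h Y p.1 p.2) a
      (contDiffAt_deformedPotential hh hY ha hx.1)
      (contDiffAt_id.prodMk contDiffAt_const)).differentiableAt (by simp)
  let u : ℝ → ℝ := fun s => Y (a + s • b) (Real.log (h * ‖x‖))
  obtain ⟨u', hu⟩ : ∃ u', HasDerivAt u u' 0 :=
    ⟨_, hYd.hasFDerivAt.comp_hasDerivAt_of_eq 0 hline hline0.symm⟩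
  have hu0 : Real.exp (u 0) - 1 = Real.sqrt c := by
    rw [← hρ]
    simp [u, radialRho]
  have hw : HasDerivAt (fun s => (Real.exp (u s) - 1) ^ 2) (2 * Real.sqrt c *
      (Real.exp (u 0) * u')) 0 := by
    refine ((hu.exp.sub_const 1).pow 2).congr_deriv ?_
    rw [hu0]
    simp
  have hΦ : HasDerivAt (fun s : ℝ => deformedPotential h Y (a + s • b) x) 0 0 := by
    have h1 := hΦd.hasFDerivAt.comp_hasDerivAt_of_eq 0 hline hline0.symm
    rw [hcon] at h1
    exact h1
  have hΦ' : HasDerivAt (fun s : ℝ => deformedPotential h Y (a + s • b) x)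
      (2 * Real.sqrt c * (Real.exp (u 0) * u') / (2 * h * ‖x‖ ^ 2)) 0 :=
    ((hw.sub_const ((h * ‖x‖ - 1) ^ 2)).div_const (2 * h * ‖x‖ ^ 2)).const_add
      (-(1 / ‖x‖) + h / 2)
  have hu' : u' = 0 := by
    have h1 := hΦ'.unique hΦ
    have h2 := (Real.exp_pos (u 0)).ne'
    have h3 : 2 * h * ‖x‖ ^ 2 ≠ 0 := by positivity
    simpa [h2, h3, hs0.ne'] using h1
  -- Since `u' = 0`, only the explicit linear dependence on the parameter contributes.
  have himp : HasDerivAt (fun s => u s + G ((Real.exp (u s) - 1) ^ 2) (a + s • b)) (G c b) 0 := by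
    have hGc : HasDerivAt (fun s => G ((Real.exp (u s) - 1) ^ 2)) 0 0 := by
      have h1 := ((hG.differentiable (by simp)) ((Real.exp (u 0) - 1) ^ 2)).hasDerivAt.scomp 0 hw
      rw [hu', mul_zero, mul_zero, zero_smul] at h1
      exact h1
    refine (hu.add (hGc.clm_apply hline)).congr_deriv ?_
    rw [hu', hu0, Real.sq_sqrt hc.1.le]
    simp
  have hconst : (fun s => u s + G ((Real.exp (u s) - 1) ^ 2) (a + s • b)) =ᶠ[𝓝 0]
      fun _ => Real.log (h * ‖x‖) := by
    have h1 : ∀ᶠ s in 𝓝 (0 : ℝ), ‖a + s • b‖ < 1 :=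
      hline.continuousAt.norm.eventually (gt_mem_nhds (by simpa using ha))
    filter_upwards [h1] with s hs using hY.apply_add _ hs _
  exact himp.unique ((hasDerivAt_const 0 (Real.log (h * ‖x‖))).congr_of_eventuallyEq hconst)

end Family

theorem corollary2 (h : ℝ) (hh : 0 < h) :
    ∃ 𝒱 : Set (Plane → ℝ),
      keplerPotential h ∈ 𝒱 ∧
      IsInfiniteDimensionalSpace (hillRegion (keplerPotential h)) 𝒱 ∧
      (∀ V ∈ 𝒱, ∀ W ∈ 𝒱, V ≠ W → ¬ EquivalentPotentials h V W) ∧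
      ∀ V ∈ 𝒱,
        IsCentralForcePotential V ∧
        hillRegion V = hillRegion (keplerPotential h) ∧
        IsZollAtZeroEnergy V := by
  obtain ⟨E, _, _, hE, hfin, G, hG, hG0, hG1, hG2⟩ := exists_smooth_linear_family
  obtain ⟨Y, hY1, hY2, hY3⟩ := exists_smooth_radial_inverse hG hG0 hG1
  have hY : IsRadialInverse G Y := ⟨hY1, hY2, hY3⟩
  have hball : ∀ {a : E}, a ∈ Metric.ball (0 : E) 1 → ‖a‖ < 1 := fun ha =>
    mem_ball_zero_iff.1 ha
  refine ⟨deformedPotential h Y '' Metric.ball 0 1,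
    ⟨0, Metric.mem_ball_self one_pos, deformedPotential_zero hh hY⟩, ?_, ?_, ?_⟩
  · refine ⟨E, _, _, hE, hfin, deformedPotential h Y, InjOn.bijOn_image ?_, ?_, ?_⟩
    · intro a ha b hb hab
      exact eq_of_equivalentPotentials hh hG hG0 hG1 hG2 hY (hball ha) (hball hb)
        fun x _ => congrFun hab x
    · rintro ⟨a, x⟩ ⟨ha, hx⟩
      exact (contDiffAt_deformedPotential hh hY (hball ha) hx).contDiffWithinAt
    · intro a ha b hb
      exact exists_fderiv_deformedPotential_ne_zero hh hG hG0 hG1 hG2 hY (hball ha) hb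
  · rintro _ ⟨a, ha, rfl⟩ _ ⟨b, hb, rfl⟩ hne heq
    exact hne (congrArg _ (eq_of_equivalentPotentials hh hG hG0 hG1 hG2 hY (hball ha)
      (hball hb) heq))
  · rintro _ ⟨a, ha, rfl⟩
    have ha := hball ha
    refine ⟨⟨deformedRadialPotential h Y a, fun r hr =>
      (contDiffAt_deformedRadialPotential_right hh hY ha hr).contDiffWithinAt, fun x _ => rfl⟩,
      hillRegion_deformedPotential hh hG hG0 hG1 hY ha, ?_⟩
    exact (isKeplerDeformation hh hG hG0 hG1 hY ha).isZollAtZeroEnergy (fun x _ => rfl)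
      fun x hx => contDiffAt_deformedPotential_right hh hY ha hx
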